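/- For $\alpha\in\mathbf R$ let $A_\alpha$ be the universal (unital) $C^*$-algebra generated by two unitaries $u,v$ with $uv=e^{2\pi i\alpha}vu$, let $\tau$ be its canonical tracial state, i.e. the continuous linear functional with $\tau(u^mv^n)=1$ if $m=n=0$ and $0$ otherwise, and let $\sigma$ be the (order four, "Fourier") $*$-automorphism of $A_\alpha$ with $\sigma(u)=v$, $\sigma(v)=u^{-1}$. For every $\alpha\in(0,1)$ the algebra $A_\alpha$ contains a projection $e_\alpha$ (that is, $e_\alpha=e_\alpha^*=e_\alpha^2$) with $\tau(e_\alpha)=\alpha$ and $\sigma(e_\alpha)=e_\alpha$. Moreover, if $\alpha\in(0,0.948]$, then $e_\alpha$ can be taken to be the following element, built from the Gaussian $f(s)=e^{-\pi s^2}$. On $L^2(\mathbf R)$ put $(\pi_{(x,y)}g)(t)=e^{2\pi i ty}g(t+x)$ for $x,y\in\mathbf R$, and let $\langle\cdot,\cdot\rangle$ be the inner product of $L^2(\mathbf R)$, linear in the first variable. Let $$D=\mathbf Z(\sqrt\alpha,0)+\mathbf Z(0,\sqrt\alpha),\qquad D^\perp=\mathbf Z(0,1/\sqrt\alpha)+\mathbf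 Z(1/\sqrt\alpha,0).$$ Then the series $$a=\langle f,f\rangle_{D^\perp}=\sum_{z\in D^\perp}\langle \pi_zf,f\rangle\,\pi_z^*$$ converges unconditionally in operator norm to a positive invertible operator on $L^2(\mathbf R)$, and, with $g=fa^{-1/2}$ (the operator $a^{-1/2}$ applied to $f$), $$e_\alpha=\langle g,g\rangle_D=\alpha\sum_{m,n\in\mathbf Z}\langle g,\pi_{(m\sqrt\alpha,\,n\sqrt\alpha)}g\rangle\,v^nu^m ,$$ where the sum converges unconditionally in the norm of $A_\alpha$. -/

import Mathlib

open scoped ENNReal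

noncomputable section

namespace Rotation

/-- `e(t) = exp (2 π i t)`. -/
def e (t : ℝ) : ℂ := Complex.exp (2 * Real.pi * Complex.I * t)

lemma e_add (s t : ℝ) : e (s + t) = e s * e t := by
  unfold e; rw [← Complex.exp_add]; congr 1; push_cast; ring

lemma e_zero : e 0 = 1 := by simp [e]

lemma e_ne_zero (t : ℝ) : e t ≠ 0 := Complex.exp_ne_zero _

lemma norm_e (t : ℝ) : ‖e t‖ = 1 := by
  unfold e
  rw [show (2 * Real.pi * Complex.I * t : ℂ) = ((2 * Real.pi * t : ℝ) : ℂ) * Complex.I by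
    push_cast; ring]
  exact Complex.norm_exp_ofReal_mul_I _

/-! ### The universal C⋆-algebra -/

/-- The separable infinite-dimensional Hilbert space `ℓ²(ℤ²)`. -/
abbrev H : Type := lp (fun _ : ℤ × ℤ => ℂ) 2

instance : Nontrivial H :=
  ⟨lp.single 2 (0 : ℤ × ℤ) (1 : ℂ), 0, fun h => by
    have := congrArg (fun x : H => x 0) h
    simp at this⟩

/-- A representation of the relation `U V = e(α) V U` by unitary operators on `ℓ²(ℤ²)`. -/
def Rep (α : ℝ) : Type :=
  {p : (H →L[ℂ] H) × (H →L[ℂ] H) //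
    p.1 ∈ unitary (H →L[ℂ] H) ∧ p.2 ∈ unitary (H →L[ℂ] H) ∧
      p.1 * p.2 = e α • (p.2 * p.1)}

/-- The C⋆-algebra of bounded families of operators indexed by all representations. -/
def Big (α : ℝ) : Type := lp (fun _ : Rep α => H →L[ℂ] H) ∞

/-- The C⋆-algebra structure: pointwise operations and the supremum norm. -/
def bigCStarAlgebra (α : ℝ) : CStarAlgebra (Big α) :=
  { (inferInstance : NormedRing (lp (fun _ : Rep α => H →L[ℂ] H) ∞)),
    (inferInstance : StarRing (lp (fun _ : Rep α => H →L[ℂ] H) ∞)),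
    (inferInstance : CompleteSpace (lp (fun _ : Rep α => H →L[ℂ] H) ∞)),
    (inferInstance : CStarRing (lp (fun _ : Rep α => H →L[ℂ] H) ∞)),
    (inferInstance : NormedAlgebra ℂ (lp (fun _ : Rep α => H →L[ℂ] H) ∞)),
    (inferInstance : StarModule ℂ (lp (fun _ : Rep α => H →L[ℂ] H) ∞)) with }

instance (α : ℝ) : CStarAlgebra (Big α) := bigCStarAlgebra α

namespace Big

/-- The component of a family at a representation. -/
def at_ {α : ℝ} (x : Big α) (p : Rep α) : H →L[ℂ] H := x.1 p

lemma ext {α : ℝ} {x y : Big α} (h : ∀ p, x.at_ p = y.at_ p) : x = y :=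
  lp.ext (funext h)

lemma at_mul {α : ℝ} (x y : Big α) (p : Rep α) : (x * y).at_ p = x.at_ p * y.at_ p := rfl

lemma at_add {α : ℝ} (x y : Big α) (p : Rep α) : (x + y).at_ p = x.at_ p + y.at_ p := rfl

lemma at_smul {α : ℝ} (c : ℂ) (x : Big α) (p : Rep α) : (c • x).at_ p = c • x.at_ p := rfl

lemma at_star {α : ℝ} (x : Big α) (p : Rep α) : (star x).at_ p = star (x.at_ p) := rfl

lemma at_one {α : ℝ} (p : Rep α) : (1 : Big α).at_ p = 1 := rfl

lemma at_algebraMap {α : ℝ} (c : ℂ) (p : Rep α) :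
    (algebraMap ℂ (Big α) c).at_ p = algebraMap ℂ (H →L[ℂ] H) c := rfl

lemma at_zero {α : ℝ} (p : Rep α) : (0 : Big α).at_ p = 0 := rfl

lemma norm_at_le {α : ℝ} (x : Big α) (p : Rep α) : ‖x.at_ p‖ ≤ ‖x‖ :=
  lp.norm_apply_le_norm (E := fun _ : Rep α => H →L[ℂ] H) (by simp) x p

lemma norm_le {α : ℝ} (x : Big α) {C : ℝ} (hC : 0 ≤ C) (h : ∀ p, ‖x.at_ p‖ ≤ C) : ‖x‖ ≤ C :=
  lp.norm_le_of_forall_le (E := fun _ : Rep α => H →L[ℂ] H) hC h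

/-- A bounded family of operators. -/
def mk {α : ℝ} (F : Rep α → H →L[ℂ] H) (C : ℝ) (hF : ∀ p, ‖F p‖ ≤ C) : Big α :=
  ⟨F, memℓp_infty ⟨C, by rintro _ ⟨p, rfl⟩; exact hF p⟩⟩

lemma at_mk {α : ℝ} (F : Rep α → H →L[ℂ] H) (C : ℝ) (hF : ∀ p, ‖F p‖ ≤ C) (p : Rep α) :
    (mk F C hF).at_ p = F p := rfl

end Big

lemma norm_le_one_of_unitary {T : H →L[ℂ] H} (hT : T ∈ unitary (H →L[ℂ] H)) : ‖T‖ ≤ 1 :=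
  (CStarRing.norm_of_mem_unitary hT).le

/-- The family whose component at `(U, V)` is `U`. -/
def uBig (α : ℝ) : Big α := Big.mk (fun p => p.1.1) 1 fun p => norm_le_one_of_unitary p.2.1

/-- The family whose component at `(U, V)` is `V`. -/
def vBig (α : ℝ) : Big α := Big.mk (fun p => p.1.2) 1 fun p => norm_le_one_of_unitary p.2.2.1

lemma at_uBig {α : ℝ} (p : Rep α) : (uBig α).at_ p = p.1.1 := rfl

lemma at_vBig {α : ℝ} (p : Rep α) : (vBig α).at_ p = p.1.2 := rfl

lemma star_uBig_mul (α : ℝ) : star (uBig α) * uBig α = 1 := Big.ext fun p => by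
  rw [Big.at_mul, Big.at_star, at_uBig, Big.at_one, Unitary.star_mul_self_of_mem p.2.1]

lemma uBig_mul_star (α : ℝ) : uBig α * star (uBig α) = 1 := Big.ext fun p => by
  rw [Big.at_mul, Big.at_star, at_uBig, Big.at_one, Unitary.mul_star_self_of_mem p.2.1]

lemma star_vBig_mul (α : ℝ) : star (vBig α) * vBig α = 1 := Big.ext fun p => by
  rw [Big.at_mul, Big.at_star, at_vBig, Big.at_one, Unitary.star_mul_self_of_mem p.2.2.1]

lemma vBig_mul_star (α : ℝ) : vBig α * star (vBig α) = 1 := Big.ext fun p => by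
  rw [Big.at_mul, Big.at_star, at_vBig, Big.at_one, Unitary.mul_star_self_of_mem p.2.2.1]

lemma uBig_mul_vBig (α : ℝ) : uBig α * vBig α = e α • (vBig α * uBig α) := Big.ext fun p => by
  rw [Big.at_mul, Big.at_smul, Big.at_mul, at_uBig, at_vBig, p.2.2.2]

/-- The closed star-subalgebra generated by the two universal unitaries. -/
def rotationSubalgebra (α : ℝ) : StarSubalgebra ℂ (Big α) :=
  (StarAlgebra.adjoin ℂ {uBig α, vBig α}).topologicalClosure

instance (α : ℝ) : IsClosed (rotationSubalgebra α : Set (Big α)) :=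
  StarSubalgebra.isClosed_topologicalClosure _

/-- The rotation algebra `A_α`: the universal C⋆-algebra generated by two unitaries `u`, `v` with
`u v = e(α) v u`.  It is the completion of the noncommutative polynomials in `u`, `v`, `u⋆`, `v⋆`
(modulo the null space) for the norm `‖P‖ = sup ‖P(U, V)‖`, the supremum being over all pairs of
unitaries `U`, `V` with `U V = e(α) V U` on a separable infinite-dimensional Hilbert space; such
pairs suffice because a C⋆-algebra with two generators is separable. -/
abbrev A (α : ℝ) : Type := rotationSubalgebra α

instance (α : ℝ) : CStarAlgebra (A α) := StarSubalgebra.cstarAlgebra _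

lemma uBig_mem (α : ℝ) : uBig α ∈ rotationSubalgebra α :=
  StarSubalgebra.le_topologicalClosure _ (StarAlgebra.subset_adjoin ℂ _ (by simp))

lemma vBig_mem (α : ℝ) : vBig α ∈ rotationSubalgebra α :=
  StarSubalgebra.le_topologicalClosure _ (StarAlgebra.subset_adjoin ℂ _ (by simp))

/-- The canonical unitary generator `u` of `A_α`. -/
def u (α : ℝ) : unitary (A α) :=
  ⟨⟨uBig α, uBig_mem α⟩, Unitary.mem_iff.2
    ⟨Subtype.ext (star_uBig_mul α), Subtype.ext (uBig_mul_star α)⟩⟩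

/-- The canonical unitary generator `v` of `A_α`. -/
def v (α : ℝ) : unitary (A α) :=
  ⟨⟨vBig α, vBig_mem α⟩, Unitary.mem_iff.2
    ⟨Subtype.ext (star_vBig_mul α), Subtype.ext (vBig_mul_star α)⟩⟩

lemma u_mul_v (α : ℝ) : (u α * v α : A α) = e α • (v α * u α : A α) :=
  Subtype.ext (uBig_mul_vBig α)

/-! ### The automorphism `σ` -/

lemma rel_swap {R : Type*} [Ring R] [StarRing R] [Algebra ℂ R] {c : ℂ} {U V : R}
    (hU : U ∈ unitary R) (h : U * V = c • (V * U)) : V * star U = c • (star U * V) := by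
  have h1 : star U * U = 1 := Unitary.star_mul_self_of_mem hU
  have h2 : U * star U = 1 := Unitary.mul_star_self_of_mem hU
  calc V * star U = star U * (U * V) * star U := by rw [← mul_assoc, h1, one_mul]
    _ = c • (star U * V * (U * star U)) := by
        rw [h, mul_smul_comm, smul_mul_assoc]; simp only [mul_assoc]
    _ = c • (star U * V) := by rw [h2, mul_one]

lemma rel_swap' {R : Type*} [Ring R] [StarRing R] [Algebra ℂ R] {c : ℂ} {U V : R}
    (hV : V ∈ unitary R) (h : U * V = c • (V * U)) : star V * U = c • (U * star V) := by
  have h1 : star V * V = 1 := Unitary.star_mul_self_of_mem hV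
  have h2 : V * star V = 1 := Unitary.mul_star_self_of_mem hV
  calc star V * U = star V * (U * V) * star V := by
        rw [mul_assoc, mul_assoc U, h2, mul_one]
    _ = c • ((star V * V) * (U * star V)) := by
        rw [h, mul_smul_comm, smul_mul_assoc]; simp only [mul_assoc]
    _ = c • (U * star V) := by rw [h1, one_mul]

/-- The permutation `(U, V) ↦ (V, U⋆)` of the representations. -/
def repEquiv (α : ℝ) : Rep α ≃ Rep α where
  toFun p := ⟨(p.1.2, star p.1.1), p.2.2.1, Unitary.star_mem p.2.1, rel_swap p.2.1 p.2.2.2⟩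
  invFun p := ⟨(star p.1.2, p.1.1), Unitary.star_mem p.2.2.1, p.2.1, rel_swap' p.2.2.1 p.2.2.2⟩
  left_inv _ := Subtype.ext (Prod.ext (star_star _) rfl)
  right_inv _ := Subtype.ext (Prod.ext rfl (star_star _))

/-- Reindexing of bounded families, a star-homomorphism. -/
def reindex {α : ℝ} (r : Rep α → Rep α) : Big α →⋆ₐ[ℂ] Big α where
  toFun x := Big.mk (fun p => x.at_ (r p)) ‖x‖ fun p => x.norm_at_le (r p)
  map_one' := Big.ext fun p => by rw [Big.at_mk, Big.at_one, Big.at_one]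
  map_mul' x y := Big.ext fun p => by simp only [Big.at_mk, Big.at_mul]
  map_zero' := Big.ext fun p => by rw [Big.at_mk, Big.at_zero, Big.at_zero]
  map_add' x y := Big.ext fun p => by simp only [Big.at_mk, Big.at_add]
  commutes' c := Big.ext fun p => by rw [Big.at_mk, Big.at_algebraMap, Big.at_algebraMap]
  map_star' x := Big.ext fun p => by simp only [Big.at_mk, Big.at_star]

lemma at_reindex {α : ℝ} (r : Rep α → Rep α) (x : Big α) (p : Rep α) :
    (reindex r x).at_ p = x.at_ (r p) := rfl

lemma reindex_uBig (α : ℝ) : reindex (repEquiv α) (uBig α) = vBig α :=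
  Big.ext fun p => by rw [at_reindex, at_uBig, at_vBig]; rfl

lemma reindex_vBig (α : ℝ) : reindex (repEquiv α) (vBig α) = star (uBig α) :=
  Big.ext fun p => by rw [at_reindex, at_vBig, Big.at_star, at_uBig]; rfl

lemma reindex_symm_uBig (α : ℝ) : reindex (repEquiv α).symm (uBig α) = star (vBig α) :=
  Big.ext fun p => by rw [at_reindex, at_uBig, Big.at_star, at_vBig]; rfl

lemma reindex_symm_vBig (α : ℝ) : reindex (repEquiv α).symm (vBig α) = uBig α :=
  Big.ext fun p => by rw [at_reindex, at_uBig, at_vBig]; rfl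

lemma continuous_reindex {α : ℝ} (r : Rep α → Rep α) : Continuous (reindex r : Big α → Big α) :=
  AddMonoidHomClass.continuous_of_bound (reindex r) 1 fun x => by
    rw [one_mul]
    exact Big.norm_le _ (norm_nonneg _) fun p => by
      rw [at_reindex]; exact x.norm_at_le (r p)

lemma reindex_mem {α : ℝ} (r : Rep α → Rep α)
    (hu : reindex r (uBig α) ∈ rotationSubalgebra α)
    (hv : reindex r (vBig α) ∈ rotationSubalgebra α) :
    ∀ x ∈ rotationSubalgebra α, reindex r x ∈ rotationSubalgebra α := by
  have h : rotationSubalgebra α ≤ (rotationSubalgebra α).comap (reindex r) := by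
    refine StarSubalgebra.topologicalClosure_minimal (StarAlgebra.adjoin_le ?_) ?_
    · intro x hx
      rw [Set.mem_insert_iff, Set.mem_singleton_iff] at hx
      rw [SetLike.mem_coe, StarSubalgebra.mem_comap]
      rcases hx with hx | hx <;> rw [hx] <;> assumption
    · rw [StarSubalgebra.coe_comap]
      exact (StarSubalgebra.isClosed_topologicalClosure _).preimage (continuous_reindex r)
  exact fun x hx => StarSubalgebra.mem_comap _ _ _ |>.1 (h hx)

lemma reindex_repEquiv_mem (α : ℝ) :
    ∀ x ∈ rotationSubalgebra α, reindex (repEquiv α) x ∈ rotationSubalgebra α :=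
  reindex_mem _ (reindex_uBig α ▸ vBig_mem α) (reindex_vBig α ▸ star_mem (uBig_mem α))

lemma reindex_repEquiv_symm_mem (α : ℝ) :
    ∀ x ∈ rotationSubalgebra α, reindex (repEquiv α).symm x ∈ rotationSubalgebra α :=
  reindex_mem _ (reindex_symm_uBig α ▸ star_mem (vBig_mem α)) (reindex_symm_vBig α ▸ uBig_mem α)

/-- The "Fourier transform" automorphism `σ` of `A_α`, with `σ(u) = v` and `σ(v) = u⁻¹`: the
component of `σ(x)` at the representation `(U, V)` is the component of `x` at `(V, U⋆)`. -/
def σ (α : ℝ) : A α ≃⋆ₐ[ℂ] A α where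
  toFun x := ⟨reindex (repEquiv α) x, reindex_repEquiv_mem α x x.2⟩
  invFun x := ⟨reindex (repEquiv α).symm x, reindex_repEquiv_symm_mem α x x.2⟩
  left_inv x := Subtype.ext (Big.ext fun p => by
    rw [at_reindex, at_reindex, Equiv.apply_symm_apply])
  right_inv x := Subtype.ext (Big.ext fun p => by
    rw [at_reindex, at_reindex, Equiv.symm_apply_apply])
  map_mul' x y := Subtype.ext (map_mul (reindex (repEquiv α)) (x : Big α) y)
  map_add' x y := Subtype.ext (map_add (reindex (repEquiv α)) (x : Big α) y)
  map_star' x := Subtype.ext (map_star (reindex (repEquiv α)) (x : Big α))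
  map_smul' c x := Subtype.ext (map_smul (reindex (repEquiv α)) c (x : Big α))

lemma σ_u (α : ℝ) : σ α (u α) = v α := Subtype.ext (reindex_uBig α)

lemma σ_v (α : ℝ) : σ α (v α) = ((u α)⁻¹ : unitary (A α)) := Subtype.ext (reindex_vBig α)

/-! ### The canonical trace -/

/-- The weighted permutation operator `(W x)(i) = c(i) x(s(i))` on `ℓ²(ℤ²)`, `|c(i)| = 1`. -/
def weightedPerm (s : Equiv.Perm (ℤ × ℤ)) (c : ℤ × ℤ → ℂ) (hc : ∀ i, ‖c i‖ = 1) :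
    H →ₗᵢ[ℂ] H where
  toFun x := ⟨fun i => c i * x (s i), by
    have := (lp.memℓp x).summable (by simp)
    refine memℓp_gen ?_
    simpa [hc, Function.comp_def] using (s.summable_iff (f := fun i => ‖x i‖ ^ (2 : ℝ≥0∞).toReal)).2 this⟩
  map_add' x y := lp.ext (funext fun i => mul_add _ _ _)
  map_smul' a x := lp.ext (funext fun i => mul_left_comm _ _ _)
  norm_map' x := by
    rw [lp.norm_eq_tsum_rpow (by simp), lp.norm_eq_tsum_rpow (by simp)]
    congr 1
    rw [← s.tsum_eq (fun i => ‖x i‖ ^ (2 : ℝ≥0∞).toReal)]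
    simp [hc]

lemma weightedPerm_surjective (s : Equiv.Perm (ℤ × ℤ)) (c : ℤ × ℤ → ℂ) (hc : ∀ i, ‖c i‖ = 1) :
    Function.Surjective (weightedPerm s c hc) := fun y => by
  have hc' : ∀ i, c i ≠ 0 := fun i h => by simpa [h] using hc i
  refine ⟨weightedPerm s.symm (fun i => (c (s.symm i))⁻¹) (fun i => by simp [hc]) y, ?_⟩
  refine lp.ext (funext fun i => ?_)
  change c i * ((c (s.symm (s i)))⁻¹ * y (s.symm (s i))) = y i
  simp [hc']

lemma weightedPerm_mem_unitary (s : Equiv.Perm (ℤ × ℤ)) (c : ℤ × ℤ → ℂ) (hc : ∀ i, ‖c i‖ = 1) :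
    (weightedPerm s c hc).toContinuousLinearMap ∈ unitary (H →L[ℂ] H) :=
  (Unitary.linearIsometryEquiv.symm
    (LinearIsometryEquiv.ofSurjective _ (weightedPerm_surjective s c hc))).2

/-- The twisted regular representation: `U δ_(m,n) = δ_(m+1,n)` and
`V δ_(m,n) = e(-α m) δ_(m,n+1)`. -/
def regRep (α : ℝ) : Rep α :=
  ⟨((weightedPerm ((Equiv.subRight 1).prodCongr (Equiv.refl ℤ)) (fun _ => 1)
      (by simp)).toContinuousLinearMap,
    (weightedPerm ((Equiv.refl ℤ).prodCongr (Equiv.subRight 1)) (fun i => e (-(α * i.1)))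
      (fun _ => norm_e _)).toContinuousLinearMap),
   weightedPerm_mem_unitary _ _ _, weightedPerm_mem_unitary _ _ _, by
    refine ContinuousLinearMap.ext fun x => lp.ext (funext fun i => ?_)
    change 1 * (e (-(α * ((i.1 - 1 : ℤ) : ℝ))) * x (i.1 - 1, i.2 - 1)) =
      e α * (e (-(α * (i.1 : ℝ))) * (1 * x (i.1 - 1, i.2 - 1)))
    rw [one_mul, one_mul, ← mul_assoc, ← e_add]
    congr 2
    push_cast; ring⟩

/-- The vector `δ_(0,0)`. -/
def δ₀ : H := lp.single 2 (0 : ℤ × ℤ) (1 : ℂ)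

/-- The canonical trace `τ` of `A_α`, with `τ(∑ a_{m,n} u^m v^n) = a_{0,0}`: the vector state of
`δ_(0,0)` in the twisted regular representation. -/
def τ (α : ℝ) : A α →L[ℂ] ℂ :=
  LinearMap.mkContinuous
    { toFun := fun x => inner ℂ δ₀ ((x : Big α).at_ (regRep α) δ₀)
      map_add' := fun x y => by
        rw [← inner_add_right, ← add_apply, ← Big.at_add]; rfl
      map_smul' := fun c x => by
        rw [RingHom.id_apply, smul_eq_mul, ← inner_smul_right, ← smul_apply,
          ← Big.at_smul]; rfl }
    1 fun x => by
      have hδ : ‖δ₀‖ = 1 := by simp [δ₀, lp.norm_single]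
      calc ‖inner ℂ δ₀ ((x : Big α).at_ (regRep α) δ₀)‖
          ≤ ‖δ₀‖ * ‖(x : Big α).at_ (regRep α) δ₀‖ := norm_inner_le_norm _ _
        _ ≤ 1 * ‖x‖ := by
          rw [hδ, one_mul, one_mul]
          refine (ContinuousLinearMap.le_opNorm _ _).trans ?_
          rw [hδ, mul_one]
          exact (x : Big α).norm_at_le (regRep α)

/-- The component at the twisted regular representation. -/
def evalReg (α : ℝ) : A α →* (H →L[ℂ] H) where
  toFun x := (x : Big α).at_ (regRep α)
  map_one' := Big.at_one _
  map_mul' x y := Big.at_mul (x : Big α) y _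

lemma zpow_apply_of_apply {W : (H →L[ℂ] H)ˣ} {d : ℤ → H} (h : ∀ k, (W : H →L[ℂ] H) (d k) = d (k + 1))
    (k : ℤ) : ((W ^ k : (H →L[ℂ] H)ˣ) : H →L[ℂ] H) (d 0) = d k := by
  induction k with
  | zero => simp
  | succ n ih => rw [add_comm, zpow_add, zpow_one, Units.val_mul,
      mul_apply_eq_comp, ih, h, add_comm]
  | pred n ih =>
    rw [sub_eq_neg_add, zpow_add, zpow_neg_one, Units.val_mul, mul_apply_eq_comp, ih]
    have h1 := h (-1 + -(n : ℤ))
    rw [show (-1 + -(n : ℤ)) + 1 = -n by ring] at h1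
    rw [← h1, ← mul_apply_eq_comp, Units.inv_mul]
    rfl

lemma weightedPerm_single (s : Equiv.Perm (ℤ × ℤ)) (c : ℤ × ℤ → ℂ) (hc : ∀ i, ‖c i‖ = 1)
    (j : ℤ × ℤ) : weightedPerm s c hc (lp.single 2 (s j) (1 : ℂ)) = c j • lp.single 2 j (1 : ℂ) := by
  refine lp.ext (funext fun i => ?_)
  change c i * (lp.single 2 (s j) (1 : ℂ) : H) (s i) = c j * (lp.single 2 j (1 : ℂ) : H) i
  rw [lp.coeFn_single, lp.coeFn_single, Pi.single_apply, Pi.single_apply]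
  by_cases hij : i = j
  · simp [hij]
  · simp [hij]

/-- The trace on monomials. -/
lemma τ_monomial (α : ℝ) (m n : ℤ) :
    τ α ((u α ^ m * v α ^ n : unitary (A α)) : A α) = if m = 0 ∧ n = 0 then 1 else 0 := by
  let U : (H →L[ℂ] H)ˣ := Units.map (evalReg α) (Unitary.toUnits (u α))
  let V : (H →L[ℂ] H)ˣ := Units.map (evalReg α) (Unitary.toUnits (v α))
  have hU : ∀ k, (U : H →L[ℂ] H) (lp.single 2 ((k, n) : ℤ × ℤ) (1 : ℂ)) =
      lp.single 2 ((k + 1, n) : ℤ × ℤ) (1 : ℂ) := fun k => by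
    have := weightedPerm_single ((Equiv.subRight 1).prodCongr (Equiv.refl ℤ)) (fun _ => 1)
      (by simp) (k + 1, n)
    rw [one_smul] at this
    rw [← this]
    simp
    rfl
  have hV : ∀ k, (V : H →L[ℂ] H) (lp.single 2 ((0, k) : ℤ × ℤ) (1 : ℂ)) =
      lp.single 2 ((0, k + 1) : ℤ × ℤ) (1 : ℂ) := fun k => by
    have := weightedPerm_single ((Equiv.refl ℤ).prodCongr (Equiv.subRight 1))
      (fun i => e (-(α * i.1))) (fun _ => norm_e _) (0, k + 1)
    simp only [Int.cast_zero, mul_zero, neg_zero, e_zero, one_smul] at this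
    rw [← this]
    simp
    rfl
  have h1 : evalReg α ((u α ^ m * v α ^ n : unitary (A α)) : A α) =
      ((U ^ m : (H →L[ℂ] H)ˣ) : H →L[ℂ] H) * ((V ^ n : (H →L[ℂ] H)ˣ) : H →L[ℂ] H) := by
    rw [← Units.val_mul, ← map_zpow, ← map_zpow, ← map_zpow, ← map_zpow, ← map_mul, ← map_mul]
    rfl
  change inner ℂ δ₀ (evalReg α ((u α ^ m * v α ^ n : unitary (A α)) : A α) δ₀) = _
  rw [h1, mul_apply_eq_comp]
  have h2 := zpow_apply_of_apply (d := fun k => lp.single 2 ((0, k) : ℤ × ℤ) (1 : ℂ)) hV n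
  have h3 := zpow_apply_of_apply (d := fun k => lp.single 2 ((k, n) : ℤ × ℤ) (1 : ℂ)) hU m
  have h4 : δ₀ = lp.single 2 ((0, 0) : ℤ × ℤ) (1 : ℂ) := rfl
  rw [h4, h2, h3, lp.inner_single_left]
  rw [lp.coeFn_single, Pi.single_apply]
  simp [Prod.ext_iff, eq_comm]

/-! ### The Heisenberg representation on `L²(ℝ)` -/

open MeasureTheory

/-- The Hilbert space `L²(ℝ)` (Lebesgue measure). -/
abbrev L2 : Type := Lp ℂ 2 (volume : Measure ℝ)

lemma memLp_shift (x y : ℝ) (g : L2) :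
    MemLp (fun t : ℝ => e (t * y) * g (t + x)) 2 (volume : Measure ℝ) := by
  have h := (Lp.memLp g).comp_measurePreserving (measurePreserving_add_right volume x)
  have he : Continuous fun t : ℝ => e (t * y) := by unfold e; fun_prop
  exact h.of_le (he.aestronglyMeasurable.mul h.1) (Filter.Eventually.of_forall fun t => by
    rw [norm_mul, norm_e, one_mul]; rfl)

/-- The time-frequency shift `(π_(x,y) g)(t) = e(t y) g(t + x)` on `L²(ℝ)`. -/
def shift (w : ℝ × ℝ) : L2 →L[ℂ] L2 :=
  LinearIsometry.toContinuousLinearMap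
    { toFun := fun g => (memLp_shift w.1 w.2 g).toLp
      map_add' := fun g h => by
        rw [← MemLp.toLp_add]
        refine MemLp.toLp_congr _ _ ?_
        filter_upwards [(measurePreserving_add_right volume w.1).quasiMeasurePreserving.ae
          (Lp.coeFn_add g h)] with t ht
        rw [ht, Pi.add_apply, Pi.add_apply, mul_add]
      map_smul' := fun c g => by
        rw [RingHom.id_apply, ← MemLp.toLp_const_smul]
        refine MemLp.toLp_congr _ _ ?_
        filter_upwards [(measurePreserving_add_right volume w.1).quasiMeasurePreserving.ae
          (Lp.coeFn_smul c g)] with t ht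
        rw [ht, Pi.smul_apply, Pi.smul_apply, smul_eq_mul, smul_eq_mul, mul_left_comm]
      norm_map' := fun g => by
        change ‖(memLp_shift w.1 w.2 g).toLp‖ = ‖g‖
        rw [Lp.norm_toLp, Lp.norm_def]
        congr 1
        rw [← eLpNorm_comp_measurePreserving (Lp.aestronglyMeasurable g)
          (measurePreserving_add_right volume w.1)]
        exact eLpNorm_congr_norm_ae (Filter.Eventually.of_forall fun t => by
          rw [norm_mul, norm_e, one_mul]; rfl) }

lemma coeFn_shift (w : ℝ × ℝ) (g : L2) :
    shift w g =ᵐ[volume] fun t : ℝ => e (t * w.2) * g (t + w.1) :=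
  MemLp.coeFn_toLp (memLp_shift w.1 w.2 g)

lemma memLp_gauss : MemLp (fun s : ℝ => ((Real.exp (-Real.pi * s ^ 2) : ℝ) : ℂ)) 2
    (volume : Measure ℝ) := by
  have hc : Continuous fun s : ℝ => Real.exp (-Real.pi * s ^ 2) := by fun_prop
  refine MemLp.ofReal ((memLp_two_iff_integrable_sq hc.aestronglyMeasurable).2 ?_)
  have := integrable_exp_neg_mul_sq (b := 2 * Real.pi) (by positivity)
  refine this.congr (Filter.Eventually.of_forall fun s => ?_)
  simp only [← Real.exp_nat_mul]
  congr 1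
  push_cast; ring

/-- The Gaussian `f(s) = exp (-π s²)`. -/
def gauss : L2 := memLp_gauss.toLp

/-- The points `m ε₁ + n ε₂` of the lattice `D`, where `ε₁ = (√α, 0)` and `ε₂ = (0, √α)`. -/
def ptD (α : ℝ) (k : ℤ × ℤ) : ℝ × ℝ := (k.1 * √α, k.2 * √α)

/-- The points `m δ₁ + n δ₂` of the dual lattice `D^⊥`, where `δ₁ = (0, 1/√α)` and
`δ₂ = (1/√α, 0)`. -/
def ptDperp (α : ℝ) (k : ℤ × ℤ) : ℝ × ℝ := (k.2 / √α, k.1 / √α)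

/-- The value `⟨f, g⟩_D(w) = ∫ f(s) conj(g(s + w')) conj(e(s w'')) ds` at `w = (w', w'')`, that
is, `⟨f, π_w g⟩` for the inner product of `L²(ℝ)` which is linear in the first variable. -/
def innerD (f g : L2) (w : ℝ × ℝ) : ℂ := inner ℂ (shift w g) f

/-- The value `⟨f, g⟩_{D^⊥}(z) = ∫ conj(f(s)) g(s + z') e(s z'') ds` at `z = (z', z'')`, that is,
`⟨π_z g, f⟩` for the inner product of `L²(ℝ)` which is linear in the first variable. -/
def innerDperp (f g : L2) (z : ℝ × ℝ) : ℂ := inner ℂ f (shift z g)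

/-- The operator `a = ⟨f, f⟩_{D^⊥} = ∑_{z ∈ D^⊥} ⟨f, f⟩_{D^⊥}(z) π_z⋆` on `L²(ℝ)` for the
Gaussian `f` (a series converging in operator norm). -/
def opA (α : ℝ) : L2 →L[ℂ] L2 :=
  ∑' k : ℤ × ℤ, innerDperp gauss gauss (ptDperp α k) • star (shift (ptDperp α k))

/-- The operator `a^{-1/2}`, through the continuous functional calculus (meaningful when `a` is
positive and invertible). -/
def invSqrt {K : Type*} [NormedAddCommGroup K] [InnerProductSpace ℂ K] [CompleteSpace K]
    (a : K →L[ℂ] K) : K →L[ℂ] K := a ^ (-(1 / 2) : ℝ)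

/-- The function `f a^{-1/2}`. -/
def gaussTight (α : ℝ) : L2 := invSqrt (opA α) gauss

/-- `x = ⟨g, g⟩_D = |G/D| ∑_{w ∈ D} ⟨g, g⟩_D(w) π_w` in `A_α`, with norm convergence.  Here the
covolume `|G/D|` is `α`, and `C⋆(D, β)` is identified with `A_α` through `π_(ε₁) = u`,
`π_(ε₂) = v`, so that `π_(m ε₁ + n ε₂) = v^n u^m`. -/
def IsInnerD (α : ℝ) (g : L2) (x : A α) : Prop :=
  HasSum (fun k : ℤ × ℤ =>
    ((α : ℂ) * innerD g g (ptD α k)) • ((v α ^ k.2 * u α ^ k.1 : unitary (A α)) : A α)) x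

end Rotation

end

open scoped ENNReal

noncomputable section

namespace Rotation

open MeasureTheory Complex Filter Topology
open scoped ComplexConjugate

/-! ### The character `e` and the time-frequency shifts -/

/-! Shifts by `D` commute with shifts by `D^⊥`, so `a` commutes with every `π_w`, `w ∈ D`. The
constant term of `√2 a` is `1`, and the absolute values of the other coefficients sum to a squared
theta series minus `1`, which is below `1` for `α ≤ 0.948`. Hence `√2 a = 1 - defect` with `‖defect‖
< 1`, and `a` is positive and invertible.

Moving one factor `a^{-1/2}` across the inner product (`innerD_gaussTight`), the coefficients of
`⟨g, g⟩_D` become `c_w = α ⟨a⁻¹ f, π_w f⟩`, where `a⁻¹ f` is `dualGauss`. All the claims are then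
statements about the `c_w`: - Summability: the fixed-point equation `a⁻¹ f = √2 f + defect (a⁻¹ f)`
propagates Gaussian bounds (`summable_norm_inner_shift_gauss_dualGauss`). - Idempotence: Janssen's
identity, `α ∑ ⟨x, π_w f⟩ π_w f = a x` for coherent states `x`, is Jacobi's transformation of a
product of two theta functions (`hasSum_janssen_coh`). By symmetry it gives `α ∑ ⟨a⁻¹ f, π_w f⟩ π_w
f = f`, and pairing this with `π_l a⁻¹ f` gives the twisted convolution identity
(`hasSum_projCoeff_conv`). - Invariance under `σ`: `f` is its own Fourier transform and `a` commutes
with the Fourier transform, so `a⁻¹ f` is fixed by it, while `π_w` turns by a right angle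
(`projCoeff_turn`). - Trace: averaging vector states over finer and finer grids gives in the limit a
trace `tr` on the algebra of `D^⊥`, with `tr(a T) = ⟨T f, f⟩`. Taking `T = a⁻¹` yields `⟨a⁻¹ f, f⟩ =
1`, so `c_0 = α` (`inner_gauss_dualGauss`).

For `α > 0.948` the pair `(v, u)` satisfies the relation with parameter `1 - α`, and the complement
of the projection built from it has trace `α`. -/

lemma conj_e (t : ℝ) : conj (e t) = e (-t) := by
  unfold e
  rw [← Complex.exp_conj]
  simp [conj_ofNat]

lemma e_int (n : ℤ) : e n = 1 := by
  unfold e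
  rw [Complex.exp_eq_one_iff]
  exact ⟨n, by push_cast; ring⟩

lemma shift_mul (w z : ℝ × ℝ) : shift w * shift z = e (w.1 * z.2) • shift (w + z) := by
  refine ContinuousLinearMap.ext fun g => Lp.ext ?_
  change (shift w (shift z g) : L2) =ᵐ[volume] (e (w.1 * z.2) • shift (w + z) g : L2)
  filter_upwards [coeFn_shift w (shift z g), coeFn_shift (w + z) g,
    Lp.coeFn_smul (e (w.1 * z.2)) (shift (w + z) g),
    (measurePreserving_add_right volume w.1).quasiMeasurePreserving.ae (coeFn_shift z g)]
    with t h1 h2 h3 h4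
  rw [h1, h3, Pi.smul_apply, h2, h4, smul_eq_mul, ← mul_assoc, ← mul_assoc, ← e_add, ← e_add,
    Prod.fst_add, Prod.snd_add, add_assoc]
  congr 2
  ring

lemma shift_zero : shift 0 = 1 := by
  refine ContinuousLinearMap.ext fun g => Lp.ext ?_
  filter_upwards [coeFn_shift 0 g] with t h1
  rw [h1]
  simp [e_zero]

lemma norm_shift_apply (w : ℝ × ℝ) (g : L2) : ‖shift w g‖ = ‖g‖ :=
  by unfold shift; rw [LinearIsometry.coe_toContinuousLinearMap, LinearIsometry.norm_map]

lemma norm_shift_le (w : ℝ × ℝ) : ‖shift w‖ ≤ 1 :=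
  ContinuousLinearMap.opNorm_le_bound _ zero_le_one fun g => by rw [norm_shift_apply, one_mul]

lemma inner_shift_shift (w : ℝ × ℝ) (g h : L2) : inner ℂ (shift w g) (shift w h) = inner ℂ g h :=
  (LinearMap.norm_map_iff_inner_map_map (shift w)).1 (norm_shift_apply w) g h

lemma star_shift_mul_self (w : ℝ × ℝ) : star (shift w) * shift w = 1 := by
  refine ContinuousLinearMap.ext fun g => ext_inner_left ℂ fun h => ?_
  change inner ℂ h (ContinuousLinearMap.adjoint (shift w) (shift w g)) = inner ℂ h g
  rw [ContinuousLinearMap.adjoint_inner_right, inner_shift_shift]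

lemma star_shift (w : ℝ × ℝ) : star (shift w) = e (w.1 * w.2) • shift (-w) := by
  have h : shift w * (e (w.1 * w.2) • shift (-w)) = 1 := by
    rw [mul_smul_comm, shift_mul, smul_smul, ← e_add, add_neg_cancel, shift_zero]
    simp [e_zero]
  calc star (shift w) = star (shift w) * (shift w * (e (w.1 * w.2) • shift (-w))) := by
        rw [h, mul_one]
    _ = _ := by rw [← mul_assoc, star_shift_mul_self, one_mul]

lemma inner_shift_left (w : ℝ × ℝ) (g h : L2) :
    inner ℂ (shift w g) h = inner ℂ g (star (shift w) h) := by
  change _ = inner ℂ g (ContinuousLinearMap.adjoint (shift w) h)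
  rw [ContinuousLinearMap.adjoint_inner_right]

lemma norm_star_shift_le (w : ℝ × ℝ) : ‖star (shift w)‖ ≤ 1 := by
  exact (LinearIsometryEquiv.norm_map ContinuousLinearMap.adjoint (shift w)).trans_le
    (norm_shift_le w)

/-! ### Coherent states -/

lemma memLp_coh (ζ : ℂ) :
    MemLp (fun t : ℝ => cexp (-Real.pi * t ^ 2 + 2 * Real.pi * ζ * t)) 2 (volume : Measure ℝ) := by
  have hc : Continuous fun t : ℝ => cexp (-Real.pi * t ^ 2 + 2 * Real.pi * ζ * t) := by fun_prop
  refine (memLp_two_iff_integrable_sq_norm hc.aestronglyMeasurable).2 ?_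
  have := (integrable_cexp_quadratic' (b := -(2 * Real.pi : ℂ)) (by simp [Real.pi_pos])
    (4 * Real.pi * ζ) 0).norm
  refine this.congr (Filter.Eventually.of_forall fun t => ?_)
  simp only [norm_exp, ← Real.exp_nat_mul]
  congr 1
  have h : (4 * Real.pi * ζ * t : ℂ) = 2 * (2 * Real.pi * ζ * t) := by ring
  rw [h]
  have h2 : (-(2 * Real.pi) * (t : ℂ) ^ 2) = 2 * (-Real.pi * t ^ 2) := by ring
  rw [h2]
  simp only [add_re, mul_re, re_ofNat, im_ofNat, zero_re]
  push_cast
  ring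

/-- The coherent state `t ↦ exp (-π t² + 2 π ζ t)`. -/
def coh (ζ : ℂ) : L2 := (memLp_coh ζ).toLp

lemma coeFn_coh (ζ : ℂ) :
    coh ζ =ᵐ[volume] fun t : ℝ => cexp (-Real.pi * t ^ 2 + 2 * Real.pi * ζ * t) :=
  MemLp.coeFn_toLp (memLp_coh ζ)

lemma coh_zero : coh 0 = gauss := by
  refine MemLp.toLp_congr _ _ (Filter.Eventually.of_forall fun t => ?_)
  simp

/-- Translation and modulation keep the leading term `-π t²` and alter only the linear and constant
terms of the exponent. So coherent states are permuted up to scalars, and everything below reduces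
to explicit Gaussians. -/
lemma shift_coh (w : ℝ × ℝ) (ζ : ℂ) :
    shift w (coh ζ) = cexp (-Real.pi * w.1 ^ 2 + 2 * Real.pi * ζ * w.1) •
      coh (ζ - w.1 + w.2 * I) := by
  refine Lp.ext ?_
  filter_upwards [coeFn_shift w (coh ζ), coeFn_coh (ζ - w.1 + w.2 * I),
    Lp.coeFn_smul (cexp (-Real.pi * w.1 ^ 2 + 2 * Real.pi * ζ * w.1)) (coh (ζ - w.1 + w.2 * I)),
    (measurePreserving_add_right volume w.1).quasiMeasurePreserving.ae (coeFn_coh ζ)]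
    with t h1 h2 h3 h4
  rw [h1, h3, Pi.smul_apply, h2, h4, smul_eq_mul, e, ← Complex.exp_add, ← Complex.exp_add]
  congr 1
  push_cast
  ring

lemma inner_coh (ζ ω : ℂ) :
    inner ℂ (coh ζ) (coh ω) = (1 / √2 : ℝ) * cexp (Real.pi * (conj ζ + ω) ^ 2 / 2) := by
  rw [L2.inner_def]
  have h : ∀ᵐ t : ℝ, inner ℂ (coh ζ t) (coh ω t) =
      cexp (-(2 * Real.pi : ℂ) * t ^ 2 + 2 * Real.pi * (conj ζ + ω) * t + 0) := by
    filter_upwards [coeFn_coh ζ, coeFn_coh ω] with t h1 h2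
    rw [h1, h2, RCLike.inner_apply, ← Complex.exp_conj, ← Complex.exp_add]
    congr 1
    simp [conj_ofNat]
    ring
  rw [integral_congr_ae h, integral_cexp_quadratic (by simp [Real.pi_pos])]
  have hpi : (Real.pi : ℂ) ≠ 0 := ofReal_ne_zero.2 Real.pi_ne_zero
  congr 1
  · rw [show (Real.pi : ℂ) / -(-(2 * Real.pi)) = ((1 / 2 : ℝ) : ℂ) by
      push_cast; field_simp, Real.sqrt_eq_rpow,
      show (1 / 2 : ℂ) = ((1 / 2 : ℝ) : ℂ) by push_cast; rfl, ← ofReal_cpow (by norm_num),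
      Real.div_rpow (by norm_num) (by norm_num), Real.one_rpow]
  · congr 1
    field_simp
    ring

lemma shift_gauss (w : ℝ × ℝ) :
    shift w gauss = cexp (-Real.pi * w.1 ^ 2) • coh (-w.1 + w.2 * I) := by
  rw [← coh_zero, shift_coh]
  congr 2 <;> simp

lemma inner_coh_shift_coh (ζ ω : ℂ) (w : ℝ × ℝ) :
    inner ℂ (coh ζ) (shift w (coh ω)) = (1 / √2 : ℝ) * cexp (-Real.pi * w.1 ^ 2 +
      2 * Real.pi * ω * w.1 + Real.pi * (conj ζ + ω - w.1 + w.2 * I) ^ 2 / 2) := by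
  rw [shift_coh, inner_smul_right, inner_coh, mul_left_comm, ← Complex.exp_add]
  congr 3
  ring

lemma inner_shift_gauss (w : ℝ × ℝ) :
    inner ℂ gauss (shift w gauss) = (1 / √2 : ℝ) *
      (cexp (-Real.pi * w.1 * w.2 * I) * cexp (-Real.pi / 2 * (w.1 ^ 2 + w.2 ^ 2))) := by
  rw [← coh_zero, inner_coh_shift_coh, ← Complex.exp_add]
  congr 2
  simp only [map_zero]
  ring_nf
  simp
  ring

lemma norm_inner_shift_gauss (w : ℝ × ℝ) :
    ‖inner ℂ gauss (shift w gauss)‖ =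
      1 / √2 * Real.exp (-Real.pi / 2 * (w.1 ^ 2 + w.2 ^ 2)) := by
  rw [inner_shift_gauss, norm_mul, norm_mul, norm_real, norm_exp, norm_exp]
  simp [← ofReal_pow, Real.sqrt_nonneg]

/-! ### The lattices -/

lemma ptD_zero (α : ℝ) : ptD α 0 = 0 := by simp [ptD]

lemma ptDperp_zero (α : ℝ) : ptDperp α 0 = 0 := by simp [ptDperp]

lemma ptD_add (α : ℝ) (k l : ℤ × ℤ) : ptD α (k + l) = ptD α k + ptD α l := by
  simp [ptD, add_mul]

lemma ptDperp_add (α : ℝ) (k l : ℤ × ℤ) : ptDperp α (k + l) = ptDperp α k + ptDperp α l := by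
  simp [ptDperp, add_div]

lemma ptD_neg (α : ℝ) (k : ℤ × ℤ) : ptD α (-k) = -ptD α k := by
  simp [ptD]

lemma ptDperp_neg (α : ℝ) (k : ℤ × ℤ) : ptDperp α (-k) = -ptDperp α k := by
  simp [ptDperp, neg_div]

/-- The factors `√α` and `1/√α` cancel, so both phases from `shift_mul` are `e` of an integer. -/
lemma commute_shift_ptD_ptDperp {α : ℝ} (hα : 0 < α) (k l : ℤ × ℤ) :
    Commute (shift (ptD α k)) (shift (ptDperp α l)) := by
  have hs : √α ≠ 0 := (Real.sqrt_pos.2 hα).ne'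
  have h1 : (ptD α k).1 * (ptDperp α l).2 = ((k.1 * l.1 : ℤ) : ℝ) := by
    simp only [ptD, ptDperp]; push_cast; field_simp
  have h2 : (ptDperp α l).1 * (ptD α k).2 = ((l.2 * k.2 : ℤ) : ℝ) := by
    simp only [ptD, ptDperp]; push_cast; field_simp
  change _ = _
  rw [shift_mul, shift_mul, h1, h2, e_int, e_int, add_comm]

lemma commute_shift_ptD_star_shift_ptDperp {α : ℝ} (hα : 0 < α) (k l : ℤ × ℤ) :
    Commute (shift (ptD α k)) (star (shift (ptDperp α l))) := by
  rw [star_shift, ← ptDperp_neg]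
  exact (commute_shift_ptD_ptDperp hα k (-l)).smul_right _

/-! ### Gaussian sums -/

lemma summable_exp_neg_mul_int_sq {c : ℝ} (hc : 0 < c) :
    Summable fun m : ℤ => Real.exp (-c * m ^ 2) := by
  have h : Summable fun n : ℕ => Real.exp (-c * n) := by
    exact (Real.summable_exp_nat_mul_iff.2 (neg_lt_zero.2 hc)).congr fun n => by rw [mul_comm]
  have h' : Summable fun n : ℕ => Real.exp (-c * (n : ℝ) ^ 2) := by
    refine h.of_nonneg_of_le (fun _ => (Real.exp_pos _).le) fun n => Real.exp_le_exp.2 ?_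
    have : (n : ℝ) ≤ (n : ℝ) ^ 2 := by exact_mod_cast Nat.le_self_pow two_ne_zero n
    nlinarith
  exact Summable.of_nat_of_neg (by simpa using h') (by simpa using h')

lemma summable_exp_neg_mul_sq_add_sq {c : ℝ} (hc : 0 < c) :
    Summable fun k : ℤ × ℤ => Real.exp (-c * ((k.1 : ℝ) ^ 2 + (k.2 : ℝ) ^ 2)) := by
  refine ((summable_exp_neg_mul_int_sq hc).mul_of_nonneg (summable_exp_neg_mul_int_sq hc)
    (fun _ => (Real.exp_pos _).le) (fun _ => (Real.exp_pos _).le)).congr fun k => ?_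
  rw [← Real.exp_add]
  ring_nf

/-- Since `(n + 1)² ≥ 1 + 3 n`, the tail is dominated by a geometric series of ratio `(1/5)³ =
1/125`. -/
lemma exp_neg_mul_succ_sq_le {c : ℝ} (hc0 : 0 < c) (hc : Real.exp (-c) ≤ 1 / 5) (n : ℕ) :
    Real.exp (-c * ((n : ℝ) + 1) ^ 2) ≤ 1 / 5 * (1 / 125) ^ n := by
  have h1 : Real.exp (-c * ((n : ℝ) + 1) ^ 2) ≤ Real.exp (-c) ^ (1 + 3 * n) := by
    rw [← Real.exp_nat_mul]
    refine Real.exp_le_exp.2 ?_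
    push_cast
    have : (n : ℝ) ≤ (n : ℝ) ^ 2 := by exact_mod_cast Nat.le_self_pow two_ne_zero n
    nlinarith
  refine h1.trans ((pow_le_pow_left₀ (Real.exp_pos _).le hc _).trans (le_of_eq ?_))
  rw [pow_add, pow_mul]
  norm_num

lemma tsum_exp_neg_mul_succ_sq_le {c : ℝ} (hc0 : 0 < c) (hc : Real.exp (-c) ≤ 1 / 5) :
    ∑' n : ℕ, Real.exp (-c * ((n : ℝ) + 1) ^ 2) ≤ 1 / 5 * (1 - 1 / 125)⁻¹ := by
  have hg : HasSum (fun n : ℕ => (1 / 5 : ℝ) * (1 / 125) ^ n) (1 / 5 * (1 - 1 / 125)⁻¹) :=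
    (hasSum_geometric_of_lt_one (by norm_num) (by norm_num)).mul_left (1 / 5)
  have h := exp_neg_mul_succ_sq_le hc0 hc
  exact (Summable.tsum_le_tsum h (hg.summable.of_nonneg_of_le (fun _ => (Real.exp_pos _).le) h)
    hg.summable).trans hg.tsum_eq.le

lemma tsum_exp_neg_mul_int_sq_le {c : ℝ} (hc0 : 0 < c) (hc : Real.exp (-c) ≤ 1 / 5) :
    ∑' m : ℤ, Real.exp (-c * m ^ 2) ≤ 1.404 := by
  have hs := summable_exp_neg_mul_int_sq hc0
  have hn : Summable fun n : ℕ => Real.exp (-c * ((n : ℤ) : ℝ) ^ 2) :=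
    hs.comp_injective Nat.cast_injective
  have hb := tsum_exp_neg_mul_succ_sq_le hc0 hc
  have hn' : Summable fun n : ℕ => Real.exp (-c * ((-((n : ℤ) + 1) : ℤ) : ℝ) ^ 2) :=
    hs.comp_injective (i := fun n : ℕ => (-((n : ℤ) + 1))) fun a b h => by simpa using h
  have h2 : ∀ n : ℕ, Real.exp (-c * (((n + 1 : ℕ) : ℤ) : ℝ) ^ 2) =
      Real.exp (-c * ((n : ℝ) + 1) ^ 2) := fun n => by push_cast; rfl
  have h3 : ∀ n : ℕ, Real.exp (-c * ((-((n : ℤ) + 1) : ℤ) : ℝ) ^ 2) =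
      Real.exp (-c * ((n : ℝ) + 1) ^ 2) := fun n => by push_cast; ring_nf
  have h4 : Real.exp (-c * (((0 : ℕ) : ℤ) : ℝ) ^ 2) = 1 := by simp
  have h5 := tsum_of_nat_of_neg_add_one (f := fun m : ℤ => Real.exp (-c * (m : ℝ) ^ 2)) hn hn'
  have h6 := hn.tsum_eq_zero_add
  rw [h4, tsum_congr h2] at h6
  rw [h5, h6, tsum_congr h3]
  have h7 : (1 / 5 : ℝ) * (1 - 1 / 125)⁻¹ ≤ 0.202 := by norm_num
  linarith

lemma tsum_exp_neg_mul_sq_add_sq_lt {c : ℝ} (hc0 : 0 < c) (hc : Real.exp (-c) ≤ 1 / 5) :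
    ∑' k : ℤ × ℤ, Real.exp (-c * ((k.1 : ℝ) ^ 2 + (k.2 : ℝ) ^ 2)) < 2 := by
  have hs := summable_exp_neg_mul_int_sq hc0
  have h := tsum_exp_neg_mul_int_sq_le hc0 hc
  have h0 : 0 ≤ ∑' m : ℤ, Real.exp (-c * m ^ 2) := tsum_nonneg fun _ => (Real.exp_pos _).le
  calc ∑' k : ℤ × ℤ, Real.exp (-c * ((k.1 : ℝ) ^ 2 + (k.2 : ℝ) ^ 2))
      = ∑' k : ℤ × ℤ, Real.exp (-c * k.1 ^ 2) * Real.exp (-c * k.2 ^ 2) := by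
        refine tsum_congr fun k => ?_
        rw [← Real.exp_add]
        ring_nf
    _ = (∑' m : ℤ, Real.exp (-c * m ^ 2)) * ∑' m : ℤ, Real.exp (-c * m ^ 2) :=
        (hs.tsum_mul_tsum hs (hs.mul_of_nonneg hs (fun _ => (Real.exp_pos _).le)
          (fun _ => (Real.exp_pos _).le))).symm
    -- `1.404² = 1.971… < 2`.
    _ < 2 := by nlinarith

lemma exp_neg_pi_div_le {α : ℝ} (hα : 0 < α) (h : α ≤ 0.948) :
    Real.exp (-(Real.pi / (2 * α))) ≤ 1 / 5 := by
  -- The origin of `0.948`: `π / 1.896 > 1.65`, and `exp 1.65 ≥ e (1 + 0.65 + 0.65²/2) > 5`.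
  have h1 : 1.65 ≤ Real.pi / (2 * α) := by
    rw [le_div_iff₀ (by positivity)]
    have := Real.pi_gt_d4
    nlinarith
  have h2 : (5 : ℝ) ≤ Real.exp 1.65 := by
    have h3 := Real.exp_one_gt_d9
    have h4 := Real.quadratic_le_exp_of_nonneg (x := 0.65) (by norm_num)
    rw [show (1.65 : ℝ) = 1 + 0.65 by norm_num, Real.exp_add]
    nlinarith
  rw [Real.exp_neg, one_div]
  exact inv_anti₀ (by norm_num) (h2.trans (Real.exp_le_exp.2 h1))

/-! ### Adjoints and commutants of unconditional sums -/

lemma _root_.HasSum.isSelfAdjoint {ι R : Type*} [AddCommMonoid R] [StarAddMonoid R]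
    [TopologicalSpace R] [T2Space R] [ContinuousStar R] {f : ι → R} {a : R} (h : HasSum f a)
    (i : ι ≃ ι) (hf : ∀ k, star (f k) = f (i k)) : IsSelfAdjoint a := by
  have h' := h.star
  simp only [hf] at h'
  exact (i.hasSum_iff.1 h').unique h

lemma _root_.HasSum.commute {ι R : Type*} [Semiring R] [TopologicalSpace R] [T2Space R]
    [IsTopologicalSemiring R] {f : ι → R} {a s : R} (h : HasSum f a)
    (hf : ∀ k, Commute s (f k)) : Commute s a := by
  refine (h.mul_left s).unique ?_
  simp only [fun k => (hf k).eq]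
  exact h.mul_right s

/-! ### The operator `a` -/

lemma norm_innerDperp_gauss {α : ℝ} (hα : 0 < α) (k : ℤ × ℤ) :
    ‖innerDperp gauss gauss (ptDperp α k)‖ =
      1 / √2 * Real.exp (-(Real.pi / (2 * α)) * ((k.1 : ℝ) ^ 2 + (k.2 : ℝ) ^ 2)) := by
  rw [innerDperp, norm_inner_shift_gauss]
  congr 2
  simp only [ptDperp, div_pow, Real.sq_sqrt hα.le]
  field_simp
  ring

lemma summable_norm_innerDperp_gauss {α : ℝ} (hα : 0 < α) :
    Summable fun k => ‖innerDperp gauss gauss (ptDperp α k)‖ := by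
  simp only [norm_innerDperp_gauss hα]
  exact (summable_exp_neg_mul_sq_add_sq (by positivity)).mul_left _

lemma norm_opA_term_le (α : ℝ) (k : ℤ × ℤ) :
    ‖innerDperp gauss gauss (ptDperp α k) • star (shift (ptDperp α k))‖ ≤
      ‖innerDperp gauss gauss (ptDperp α k)‖ := by
  rw [norm_smul]
  exact mul_le_of_le_one_right (norm_nonneg _) (norm_star_shift_le _)

lemma summable_opA {α : ℝ} (hα : 0 < α) :
    Summable fun k : ℤ × ℤ =>
      innerDperp gauss gauss (ptDperp α k) • star (shift (ptDperp α k)) :=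
  Summable.of_norm_bounded (summable_norm_innerDperp_gauss hα) (norm_opA_term_le α)

lemma hasSum_opA {α : ℝ} (hα : 0 < α) :
    HasSum (fun k : ℤ × ℤ => innerDperp gauss gauss (ptDperp α k) • star (shift (ptDperp α k)))
      (opA α) := (summable_opA hα).hasSum

lemma _root_.HasSum.smul_clm_apply {ι E : Type*} [NormedAddCommGroup E] [NormedSpace ℂ E]
    {c : ι → ℂ} {T : ι → E →L[ℂ] E} {A : E →L[ℂ] E} (h : HasSum (fun k => c k • T k) A) (g : E) :
    HasSum (fun k => c k • T k g) (A g) := by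
  simpa using (ContinuousLinearMap.apply ℂ E g).hasSum h

lemma hasSum_opA_apply {α : ℝ} (hα : 0 < α) (g : L2) :
    HasSum (fun k : ℤ × ℤ => innerDperp gauss gauss (ptDperp α k) • star (shift (ptDperp α k)) g)
      (opA α g) :=
  (hasSum_opA hα).smul_clm_apply g

lemma innerDperp_neg (g h : L2) (z : ℝ × ℝ) :
    innerDperp g h (-z) = e (-(z.1 * z.2)) * conj (innerDperp h g z) := by
  rw [innerDperp, innerDperp, inner_conj_symm, inner_shift_left, star_shift, smul_apply,
    inner_smul_right, ← mul_assoc, ← e_add, neg_add_cancel, e_zero, one_mul]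

lemma star_smul_star {R : Type*} [Ring R] [StarRing R] [Module ℂ R] [StarModule ℂ R]
    (c : ℂ) (x : R) : star (c • star x) = conj c • x := by
  rw [star_smul, star_star, starRingEnd_apply]

lemma star_opA_term (α : ℝ) (k : ℤ × ℤ) :
    star (innerDperp gauss gauss (ptDperp α k) • star (shift (ptDperp α k))) =
      innerDperp gauss gauss (ptDperp α (-k)) • star (shift (ptDperp α (-k))) := by
  generalize hz : ptDperp α k = z
  have h2 : star (shift (-z)) = e (z.1 * z.2) • shift z := by
    rw [star_shift, neg_neg, Prod.fst_neg, Prod.snd_neg, neg_mul_neg]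
  have h3 : e (-(z.1 * z.2)) * e (z.1 * z.2) = 1 := by rw [← e_add, neg_add_cancel, e_zero]
  rw [ptDperp_neg, hz, star_smul_star, h2, innerDperp_neg, smul_smul, mul_right_comm, h3, one_mul]

lemma isSelfAdjoint_opA {α : ℝ} (hα : 0 < α) : IsSelfAdjoint (opA α) := by
  exact HasSum.isSelfAdjoint (hasSum_opA hα) (Equiv.neg _) (star_opA_term α)

lemma commute_shift_opA {α : ℝ} (hα : 0 < α) (k : ℤ × ℤ) : Commute (shift (ptD α k)) (opA α) := by
  exact HasSum.commute (hasSum_opA hα)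
    fun l => (commute_shift_ptD_star_shift_ptDperp hα k l).smul_right _

/-- The defect `1 - √2 a`, a strict contraction for `α ≤ 0.948`. -/
def defect (α : ℝ) : L2 →L[ℂ] L2 := 1 - (√2 : ℂ) • opA α

lemma sqrt_two_smul_opA (α : ℝ) : (√2 : ℂ) • opA α = 1 - defect α := by
  rw [defect, sub_sub_cancel]

lemma innerDperp_gauss_zero (α : ℝ) : innerDperp gauss gauss (ptDperp α 0) = (1 / √2 : ℝ) := by
  rw [innerDperp, ptDperp_zero, inner_shift_gauss]
  simp

/-- The coefficients of the defect. -/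
def defectCoeff (α : ℝ) (k : ℤ × ℤ) : ℂ :=
  if k = 0 then 0 else -(√2 * innerDperp gauss gauss (ptDperp α k))

lemma hasSum_defect {α : ℝ} (hα : 0 < α) :
    HasSum (fun k => defectCoeff α k • star (shift (ptDperp α k))) (defect α) := by
  have h2 : (√2 : ℂ) * (1 / √2 : ℝ) = 1 := by
    rw [← ofReal_mul]
    simp
  have h := (hasSum_ite_eq (0 : ℤ × ℤ) (1 : L2 →L[ℂ] L2)).sub
    ((hasSum_opA hα).const_smul (√2 : ℂ))
  suffices hk : (fun k => defectCoeff α k • star (shift (ptDperp α k))) = fun k => _ - _ from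
    hk ▸ h
  funext k
  by_cases hk : k = 0
  · subst hk
    rw [innerDperp_gauss_zero, ptDperp_zero, shift_zero, smul_smul, h2, defectCoeff]
    simp
  · rw [defectCoeff, if_neg hk, if_neg hk, smul_smul, zero_sub, neg_smul]

lemma norm_defectCoeff {α : ℝ} (hα : 0 < α) (k : ℤ × ℤ) :
    ‖defectCoeff α k‖ = Real.exp (-(Real.pi / (2 * α)) * ((k.1 : ℝ) ^ 2 + (k.2 : ℝ) ^ 2)) -
      if k = 0 then 1 else 0 := by
  by_cases hk : k = 0
  · simp [hk, defectCoeff]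
  · rw [defectCoeff, if_neg hk, if_neg hk, sub_zero, norm_neg, norm_mul,
      norm_innerDperp_gauss hα, norm_real, Real.norm_of_nonneg (Real.sqrt_nonneg _),
      ← mul_assoc, mul_one_div_cancel (by positivity), one_mul]

lemma summable_norm_defectCoeff {α : ℝ} (hα : 0 < α) : Summable fun k => ‖defectCoeff α k‖ := by
  simp only [norm_defectCoeff hα]
  exact (summable_exp_neg_mul_sq_add_sq (by positivity)).sub (hasSum_ite_eq _ _).summable

/-- The full double Gaussian sum is below `2`; the defect omits its term `1` at the origin. -/
lemma tsum_norm_defectCoeff_lt_one {α : ℝ} (hα : 0 < α) (h : α ≤ 0.948) :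
    ∑' k, ‖defectCoeff α k‖ < 1 := by
  simp only [norm_defectCoeff hα]
  rw [(summable_exp_neg_mul_sq_add_sq (by positivity)).tsum_sub (hasSum_ite_eq _ _).summable,
    tsum_ite_eq]
  have := tsum_exp_neg_mul_sq_add_sq_lt (by positivity) (exp_neg_pi_div_le hα h)
  linarith

lemma norm_defect_lt_one {α : ℝ} (hα : 0 < α) (h : α ≤ 0.948) : ‖defect α‖ < 1 := by
  rw [← (hasSum_defect hα).tsum_eq]
  refine (tsum_of_norm_bounded (summable_norm_defectCoeff hα).hasSum fun k => ?_).trans_lt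
    (tsum_norm_defectCoeff_lt_one hα h)
  rw [norm_smul]
  exact mul_le_of_le_one_right (norm_nonneg _) (norm_star_shift_le _)

lemma isUnit_opA {α : ℝ} (hα : 0 < α) (h : α ≤ 0.948) : IsUnit (opA α) := by
  have h1 : IsUnit ((√2 : ℂ) • opA α) := by
    rw [sqrt_two_smul_opA]
    exact isUnit_one_sub_of_norm_lt_one (norm_defect_lt_one hα h)
  have h2 : (√2 : ℂ) ≠ 0 := by simp
  exact (isUnit_smul_iff (Units.mk0 _ h2) _).1 h1

/-- `√2 ⟨a g, g⟩ = ‖g‖² - Re ⟨defect g, g⟩`, and the defect is a contraction. -/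
lemma opA_nonneg {α : ℝ} (hα : 0 < α) (h : α ≤ 0.948) : 0 ≤ opA α := by
  rw [ContinuousLinearMap.nonneg_iff_isPositive, ContinuousLinearMap.isPositive_def']
  refine ⟨isSelfAdjoint_opA hα, fun g => ?_⟩
  have h1 : (√2 : ℂ) • opA α g = g - defect α g := by
    rw [← smul_apply, sqrt_two_smul_opA]
    rfl
  have h2 : ‖inner ℂ (defect α g) g‖ ≤ ‖g‖ ^ 2 := by
    refine (norm_inner_le_norm _ _).trans ?_
    have := (defect α).le_of_opNorm_le (norm_defect_lt_one hα h).le g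
    nlinarith [norm_nonneg g]
  have h3 := (re_le_norm (inner ℂ (defect α g) g)).trans h2
  have h4 : √2 * (opA α).reApplyInnerSelf g = ‖g‖ ^ 2 - (inner ℂ (defect α g) g).re := by
    rw [ContinuousLinearMap.reApplyInnerSelf_apply, ← inner_self_eq_norm_sq (𝕜 := ℂ) g]
    change √2 * (inner ℂ (opA α g) g).re = (inner ℂ g g).re - _
    rw [← sub_re, ← inner_sub_left, ← h1, inner_smul_left, conj_ofReal, re_ofReal_mul]
  have h5 : 0 < √2 := by positivity
  nlinarith

/-! ### The Janssen identity for coherent states -/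

lemma _root_.HasSum.mul_of_summable_norm {ι κ R : Type*} [NormedRing R] [CompleteSpace R]
    {f : ι → R} {g : κ → R} {a b : R} (hf : HasSum f a) (hg : HasSum g b)
    (hf' : Summable fun i => ‖f i‖) (hg' : Summable fun i => ‖g i‖) :
    HasSum (fun k : ι × κ => f k.1 * g k.2) (a * b) :=
  hf.mul hg (summable_mul_of_summable_norm hf' hg')

lemma hasSum_jacobiTheta₂_term_mul (z₁ z₂ : ℂ) {τ : ℂ} (hτ : 0 < τ.im) :
    HasSum (fun k : ℤ × ℤ => jacobiTheta₂_term k.1 z₁ τ * jacobiTheta₂_term k.2 z₂ τ)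
      (jacobiTheta₂ z₁ τ * jacobiTheta₂ z₂ τ) := by
  have h1 := hasSum_jacobiTheta₂_term z₁ hτ
  have h2 := hasSum_jacobiTheta₂_term z₂ hτ
  have h3 := h1.mul_of_summable_norm h2 h1.summable.norm h2.summable.norm
  exact h3

/-- Poisson summation linking `D` to `D^⊥`. Each theta function contributes a factor `α^{-1/2}`,
whence the `1/α`, and the two Gaussian prefactors merge into one exponential. -/
lemma jacobiTheta₂_mul_functional_equation {α : ℝ} (hα : 0 < α) (s d : ℂ) :
    jacobiTheta₂ (I * √α * s / 2) (I * α) * jacobiTheta₂ (-√α * d / 2) (I * α) =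
      1 / α * (cexp (Real.pi * (s ^ 2 - d ^ 2) / 4) *
        (jacobiTheta₂ (-s / (2 * √α)) (I / α) * jacobiTheta₂ (I * d / (2 * √α)) (I / α))) := by
  have hα' : (α : ℂ) ≠ 0 := ofReal_ne_zero.2 hα.ne'
  have hs : (√α : ℂ) ≠ 0 := ofReal_ne_zero.2 (Real.sqrt_pos.2 hα).ne'
  have hss : (√α : ℂ) ^ 2 = α := by rw [← ofReal_pow, Real.sq_sqrt hα.le]
  have h1 : (-I * (I * α)) ^ (1 / 2 : ℂ) * (-I * (I * α)) ^ (1 / 2 : ℂ) = (α : ℂ) := by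
    rw [← Complex.cpow_add _ _ (by simp [hα'])]
    rw [← mul_assoc, neg_mul, I_mul_I]
    norm_num
  rw [jacobiTheta₂_functional_equation (I * √α * s / 2),
    jacobiTheta₂_functional_equation (-√α * d / 2), ← jacobiTheta₂_neg_left (-s / (2 * √α))]
  have h2 : I * √α * s / 2 / (I * α) = -(-s / (2 * √α)) := by
    rw [← hss]
    field_simp
  have h3 : -√α * d / 2 / (I * α) = I * d / (2 * √α) := by
    rw [← hss]
    field_simp
    simp
  have h4 : -1 / (I * α) = I / α := by
    field_simp
    simp
  rw [h2, h3, h4]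
  have h5 : cexp (Real.pi * (s ^ 2 - d ^ 2) / 4) =
      cexp (-Real.pi * I * (I * √α * s / 2) ^ 2 / (I * α)) *
        cexp (-Real.pi * I * (-√α * d / 2) ^ 2 / (I * α)) := by
    rw [← Complex.exp_add]
    congr 1
    simp only [mul_pow, div_pow, I_sq, hss, neg_sq]
    field_simp
    ring
  have h6 : ∀ x A B C D : ℂ, 1 / x * A * B * (1 / x * C * D) = 1 / (x * x) * (A * C * (B * D)) := by
    intro x A B C D
    rw [one_div, one_div, mul_inv]
    ring
  rw [h5, h6, h1]

lemma inv_sqrt_two_mul_self : ((1 / √2 : ℝ) : ℂ) * (1 / √2 : ℝ) = 1 / 2 := by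
  rw [← ofReal_mul, div_mul_div_comm, one_mul, Real.mul_self_sqrt (by norm_num)]
  push_cast
  rfl

lemma conj_inv_sqrt_two : conj ((1 / √2 : ℝ) : ℂ) = (1 / √2 : ℝ) := conj_ofReal _

/-- The terms in `k.1 * k.2` cancel between the two inner products, so the summand splits into two
one-dimensional theta terms, in `ζ + conj ω` and `ζ - conj ω`. The same happens over `D^⊥` in the
next lemma. -/
lemma inner_mul_inner_ptD_eq {α : ℝ} (hα : 0 < α) (ζ ω : ℂ) (k : ℤ × ℤ) :
    inner ℂ (shift (ptD α k) gauss) (coh ζ) * inner ℂ (coh ω) (shift (ptD α k) gauss) =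
      1 / 2 * cexp (Real.pi * (ζ ^ 2 + conj ω ^ 2) / 2) *
        (jacobiTheta₂_term k.1 (I * √α * (ζ + conj ω) / 2) (I * α) *
          jacobiTheta₂_term k.2 (-√α * (ζ - conj ω) / 2) (I * α)) := by
  have hss : (α : ℂ) = (√α : ℂ) ^ 2 := by rw [← ofReal_pow, Real.sq_sqrt hα.le]
  rw [← inner_conj_symm, ← coh_zero, inner_coh_shift_coh, inner_coh_shift_coh, map_mul,
    conj_inv_sqrt_two, mul_mul_mul_comm, inv_sqrt_two_mul_self, mul_assoc, ← Complex.exp_conj,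
    jacobiTheta₂_term, jacobiTheta₂_term, ← Complex.exp_add, ← Complex.exp_add,
    mul_assoc (1 / 2) (cexp _) (cexp _), ← Complex.exp_add, hss]
  congr 2
  simp only [ptD, map_add, map_mul, map_neg, map_sub, map_pow, map_div₀, conj_ofReal, conj_I,
    conj_conj, map_ofNat, map_zero]
  push_cast
  linear_combination (-Real.pi * k.1 * √α * (ζ + conj ω) - Real.pi * k.1 ^ 2 * √α ^ 2 : ℂ) * I_sq

lemma inner_mul_inner_ptDperp_eq {α : ℝ} (hα : 0 < α) (ζ ω : ℂ) (k : ℤ × ℤ) :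
    innerDperp gauss gauss (ptDperp α k) *
        inner ℂ (coh ω) (star (shift (ptDperp α k)) (coh ζ)) =
      1 / 2 * cexp (Real.pi * (ζ + conj ω) ^ 2 / 2) *
        (jacobiTheta₂_term k.1 (-(ζ + conj ω) / (2 * √α)) (I / α) *
          jacobiTheta₂_term k.2 (I * (ζ - conj ω) / (2 * √α)) (I / α)) := by
  have hss : (α : ℂ) = (√α : ℂ) ^ 2 := by rw [← ofReal_pow, Real.sq_sqrt hα.le]
  have hs : (√α : ℂ) ≠ 0 := ofReal_ne_zero.2 (Real.sqrt_pos.2 hα).ne'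
  rw [← inner_shift_left, innerDperp, ← inner_conj_symm (shift _ _) (coh ζ), ← coh_zero,
    inner_coh_shift_coh, inner_coh_shift_coh, map_mul,
    conj_inv_sqrt_two, mul_mul_mul_comm, inv_sqrt_two_mul_self, mul_assoc, ← Complex.exp_conj,
    jacobiTheta₂_term, jacobiTheta₂_term, ← Complex.exp_add, ← Complex.exp_add,
    mul_assoc (1 / 2) (cexp _) (cexp _), ← Complex.exp_add, hss]
  congr 2
  simp only [ptDperp, map_add, map_mul, map_neg, map_sub, map_pow, map_div₀, conj_ofReal, conj_I,
    conj_conj, map_ofNat, map_zero]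
  push_cast
  field_simp
  ring_nf
  simp only [I_sq]
  ring

lemma hasSum_janssen_coh {α : ℝ} (hα : 0 < α) (ζ ω : ℂ) :
    HasSum (fun k => inner ℂ (shift (ptD α k) gauss) (coh ζ) *
        inner ℂ (coh ω) (shift (ptD α k) gauss))
      (1 / α * inner ℂ (coh ω) (opA α (coh ζ))) := by
  have hτ : 0 < (I * α : ℂ).im := by simpa using hα
  have hτ' : 0 < (I / α : ℂ).im := by simpa [div_ofReal_im] using hα
  have h1 : inner ℂ (coh ω) (opA α (coh ζ)) = 1 / 2 * cexp (Real.pi * (ζ + conj ω) ^ 2 / 2) *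
        (jacobiTheta₂ (-(ζ + conj ω) / (2 * √α)) (I / α) *
          jacobiTheta₂ (I * (ζ - conj ω) / (2 * √α)) (I / α)) := by
    have h2 := (innerSL ℂ (coh ω)).hasSum (hasSum_opA_apply hα (coh ζ))
    simp only [innerSL_apply_apply, inner_smul_right] at h2
    simp only [inner_mul_inner_ptDperp_eq hα] at h2
    exact h2.unique ((hasSum_jacobiTheta₂_term_mul _ _ hτ').mul_left _)
  have h3 : cexp (Real.pi * (ζ + conj ω) ^ 2 / 2) = cexp (Real.pi * (ζ ^ 2 + conj ω ^ 2) / 2) *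
      cexp (Real.pi * ((ζ + conj ω) ^ 2 - (ζ - conj ω) ^ 2) / 4) := by
    rw [← Complex.exp_add]
    congr 1
    ring
  have h4 := (hasSum_jacobiTheta₂_term_mul (I * √α * (ζ + conj ω) / 2) (-√α * (ζ - conj ω) / 2)
    hτ).mul_left (1 / 2 * cexp (Real.pi * (ζ ^ 2 + conj ω ^ 2) / 2))
  rw [jacobiTheta₂_mul_functional_equation hα] at h4
  simp only [inner_mul_inner_ptD_eq hα]
  rw [h1, h3]
  have h5 : ∀ x y z w : ℂ, 1 / α * (1 / 2 * (x * y) * (z * w)) =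
      1 / 2 * x * (1 / α * (y * (z * w))) := by intros; ring
  rw [h5]
  exact h4

/-! ### Closed subspaces invariant under a contraction -/

/-- The distance from `x` to `V` is at most `‖T‖` times itself, hence zero. This is used for
vectors, for pairs of vectors and for operators. -/
lemma mem_of_eq_add_of_norm_lt_one {E : Type*} [NormedAddCommGroup E] [NormedSpace ℂ E]
    {V : Submodule ℂ E} (hV : IsClosed (V : Set E)) {T : E →L[ℂ] E} (hT : ‖T‖ < 1)
    (hTV : ∀ v ∈ V, T v ∈ V) {x x₀ : E} (hx₀ : x₀ ∈ V) (hx : x = x₀ + T x) : x ∈ V := by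
  have hne : (V : Set E).Nonempty := ⟨x₀, hx₀⟩
  have h1 : Metric.infDist x V ≤ ‖T‖ * Metric.infDist x V := by
    by_contra! hlt
    have h2 : 0 < ‖T‖ ∨ ‖T‖ = 0 := (norm_nonneg T).lt_or_eq.imp_right Eq.symm
    have key : ∀ v ∈ V, Metric.infDist x V ≤ ‖T‖ * dist x v := fun v hv => by
      -- The competitor `x₀ + T v` lies in `V`, and its difference from `x` is `T (x - v)`.
      refine (Metric.infDist_le_dist_of_mem (V.add_mem hx₀ (hTV v hv))).trans ?_
      rw [dist_eq_norm, dist_eq_norm]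
      calc ‖x - (x₀ + T v)‖ = ‖T (x - v)‖ := by
            rw [map_sub]; nth_rw 1 [hx]; congr 1; abel
        _ ≤ _ := T.le_opNorm _
    rcases h2 with h2 | h2
    · have h3 : Metric.infDist x V < Metric.infDist x V / ‖T‖ := by
        rw [lt_div_iff₀ h2, mul_comm]; exact hlt
      obtain ⟨v, hv, hd⟩ := (Metric.infDist_lt_iff hne).1 h3
      rw [lt_div_iff₀ h2, mul_comm] at hd
      exact (key v hv).not_gt hd
    · have := key x₀ hx₀
      rw [h2, zero_mul] at this hlt
      exact this.not_gt hlt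
  have h0 : Metric.infDist x V = 0 := by
    have := Metric.infDist_nonneg (x := x) (s := (V : Set E))
    nlinarith
  exact (hV.mem_iff_infDist_zero hne).2 h0

lemma mem_of_hasSum {ι E : Type*} [NormedAddCommGroup E] [NormedSpace ℂ E]
    {V : Submodule ℂ E} (hV : IsClosed (V : Set E)) {f : ι → E} {x : E} (h : HasSum f x)
    (hf : ∀ i, f i ∈ V) : x ∈ V :=
  hV.mem_of_tendsto h (Filter.Eventually.of_forall fun _ => V.sum_mem fun i _ => hf i)

/-- A continuous linear map sending `s` into a closed subspace sends the closed span of `s`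
into it. -/
lemma map_mem_of_mem_closure_span {E F : Type*} [NormedAddCommGroup E] [NormedSpace ℂ E]
    [NormedAddCommGroup F] [NormedSpace ℂ F] {s : Set E} {V : Submodule ℂ F}
    (hV : IsClosed (V : Set F)) (T : E →L[ℂ] F) (h : ∀ x ∈ s, T x ∈ V) :
    ∀ x ∈ (Submodule.span ℂ s).topologicalClosure, T x ∈ V := by
  have h1 : (Submodule.span ℂ s).topologicalClosure ≤ V.comap (T : E →ₗ[ℂ] F) := by
    refine Submodule.topologicalClosure_minimal _ (Submodule.span_le.2 h) ?_
    exact hV.preimage T.continuous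
  exact fun x hx => h1 hx

lemma map_eq_zero_of_mem_closure_span {E F : Type*} [NormedAddCommGroup E] [NormedSpace ℂ E]
    [NormedAddCommGroup F] [NormedSpace ℂ F] {s : Set E} (T : E →L[ℂ] F)
    (h : ∀ x ∈ s, T x = 0) : ∀ x ∈ (Submodule.span ℂ s).topologicalClosure, T x = 0 := by
  simpa using map_mem_of_mem_closure_span (V := (⊥ : Submodule ℂ F)) isClosed_singleton T
    (by simpa using h)

/-! ### The vector `a⁻¹ f` -/

/-- The dual window `a⁻¹ f` of the Gaussian `f`. -/
def dualGauss (α : ℝ) : L2 := Ring.inverse (opA α) gauss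

lemma opA_dualGauss {α : ℝ} (hα : 0 < α) (h : α ≤ 0.948) : opA α (dualGauss α) = gauss := by
  change (opA α * Ring.inverse (opA α)) gauss = gauss
  rw [Ring.mul_inverse_cancel _ (isUnit_opA hα h)]
  rfl

lemma dualGauss_eq {α : ℝ} (hα : 0 < α) (h : α ≤ 0.948) :
    dualGauss α = (√2 : ℂ) • gauss + defect α (dualGauss α) := by
  have h1 : (√2 : ℂ) • opA α (dualGauss α) = dualGauss α - defect α (dualGauss α) := by
    rw [← smul_apply, sqrt_two_smul_opA]
    rfl
  rw [← opA_dualGauss hα h, h1, sub_add_cancel]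

/-- The closed linear span of the coherent states. -/
def cohSpan : Submodule ℂ L2 := (Submodule.span ℂ (Set.range coh)).topologicalClosure

lemma isClosed_cohSpan : IsClosed (cohSpan : Set L2) := Submodule.isClosed_topologicalClosure _

lemma coh_mem (ζ : ℂ) : coh ζ ∈ cohSpan :=
  Submodule.le_topologicalClosure _ (Submodule.subset_span ⟨ζ, rfl⟩)

lemma gauss_mem : gauss ∈ cohSpan := coh_zero ▸ coh_mem 0

lemma shift_mem (w : ℝ × ℝ) : ∀ g ∈ cohSpan, shift w g ∈ cohSpan := by
  refine map_mem_of_mem_closure_span isClosed_cohSpan (shift w) ?_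
  rintro _ ⟨ζ, rfl⟩
  rw [shift_coh]
  exact cohSpan.smul_mem _ (coh_mem _)

lemma star_shift_mem (w : ℝ × ℝ) : ∀ g ∈ cohSpan, star (shift w) g ∈ cohSpan := fun g hg => by
  rw [star_shift, smul_apply]
  exact cohSpan.smul_mem _ (shift_mem _ g hg)

lemma hasSum_defect_apply {α : ℝ} (hα : 0 < α) (g : L2) :
    HasSum (fun k => defectCoeff α k • star (shift (ptDperp α k)) g) (defect α g) :=
  (hasSum_defect hα).smul_clm_apply g

lemma opA_mem {α : ℝ} (hα : 0 < α) : ∀ g ∈ cohSpan, opA α g ∈ cohSpan := fun g hg =>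
  mem_of_hasSum isClosed_cohSpan (hasSum_opA_apply hα g)
    fun _ => cohSpan.smul_mem _ (star_shift_mem _ g hg)

/-- Restricting to `cohSpan` makes it unnecessary to know that coherent states are total in `L²(ℝ)`:
every vector to be compared already lies there. -/
lemma eq_of_forall_inner_coh_eq {x y : L2} (hx : x ∈ cohSpan) (hy : y ∈ cohSpan)
    (h : ∀ ω, inner ℂ (coh ω) x = inner ℂ (coh ω) y) : x = y := by
  have h1 := map_eq_zero_of_mem_closure_span (s := Set.range coh) (innerSL ℂ (x - y)) (by
    rintro _ ⟨ω, rfl⟩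
    rw [innerSL_apply_apply, inner_eq_zero_symm, inner_sub_right, h, sub_self])
    (x - y) (cohSpan.sub_mem hx hy)
  rw [innerSL_apply_apply, inner_self_eq_zero] at h1
  exact sub_eq_zero.1 h1

/-! ### Summability of the coefficients -/

lemma norm_inner_shift_shift (g h : L2) (w z : ℝ × ℝ) :
    ‖inner ℂ g (shift w (shift z h))‖ = ‖inner ℂ g (shift (w + z) h)‖ := by
  change ‖inner ℂ g ((shift w * shift z) h)‖ = _
  rw [shift_mul, smul_apply, inner_smul_right, norm_mul, norm_e, one_mul]

lemma norm_inner_shift_star_shift (g h : L2) (w z : ℝ × ℝ) :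
    ‖inner ℂ g (shift w (star (shift z) h))‖ = ‖inner ℂ g (shift (w - z) h)‖ := by
  rw [star_shift, smul_apply, map_smul, inner_smul_right, norm_mul, norm_e, one_mul,
    norm_inner_shift_shift, sub_eq_add_neg]

lemma norm_inner_shift_gauss_shift_gauss (w z : ℝ × ℝ) :
    ‖inner ℂ (shift w gauss) (shift z gauss)‖ =
      1 / √2 * Real.exp (-Real.pi / 2 * ((z.1 - w.1) ^ 2 + (z.2 - w.2) ^ 2)) := by
  rw [← inner_shift_shift (-w), norm_inner_shift_shift]
  have h : shift (-w) (shift w gauss) = e (-(w.1 * w.2)) • gauss := by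
    change (shift (-w) * shift w) gauss = _
    rw [shift_mul, neg_add_cancel, shift_zero, smul_apply, Prod.fst_neg, neg_mul]
    rfl
  rw [h, inner_smul_left, norm_mul, conj_e, norm_e, one_mul, norm_inner_shift_gauss,
    Prod.fst_add, Prod.snd_add, Prod.fst_neg, Prod.snd_neg]
  ring_nf

/-- With `j = ⌊x / s⌋`, `r = x - j s ∈ [0, s)` and `A = (j - k) s`, this is `(A + r)² ≥ A²/2 - r²`,
equivalent to `(A + 2 r)² ≥ 0`. -/
lemma exists_int_mul_sub_sq_le {s : ℝ} (hs : 0 < s) (x : ℝ) :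
    ∃ j : ℤ, ∀ k : ℤ, ((j - k : ℤ) : ℝ) ^ 2 * s ^ 2 / 2 - s ^ 2 ≤ (x - k * s) ^ 2 := by
  refine ⟨⌊x / s⌋, fun k => ?_⟩
  have h1 : (⌊x / s⌋ : ℝ) * s ≤ x := (le_div_iff₀ hs).1 (Int.floor_le _)
  have h2 : x < (⌊x / s⌋ + 1 : ℝ) * s := (div_lt_iff₀ hs).1 (Int.lt_floor_add_one _)
  set j := ⌊x / s⌋
  push_cast
  have h3 : (x - j * s) ^ 2 ≤ s ^ 2 := by nlinarith
  nlinarith [sq_nonneg ((j - k) * s + 2 * (x - j * s))]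

/-- Bound for the sum of the Gaussian over a translate of the lattice `D`. -/
lemma exists_sum_norm_inner_shift_gauss_le {α : ℝ} (hα : 0 < α) :
    ∃ C : ℝ, ∀ (z : ℝ × ℝ) (F : Finset (ℤ × ℤ)),
      ∑ k ∈ F, ‖inner ℂ (shift (ptD α k) gauss) (shift z gauss)‖ ≤ C := by
  have hs := summable_exp_neg_mul_sq_add_sq (c := Real.pi * α / 4) (by positivity)
  -- `exists_int_mul_sub_sq_le` in both coordinates, with `s² = α`, bounds the squared distance
  -- below by `α/2 |j - k|² - 2 α`; multiplying by `-π/2` gives the two exponents.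
  refine ⟨1 / √2 * (Real.exp (Real.pi * α) * ∑' k : ℤ × ℤ,
    Real.exp (-(Real.pi * α / 4) * ((k.1 : ℝ) ^ 2 + (k.2 : ℝ) ^ 2))), fun z F => ?_⟩
  have hsq : √α ^ 2 = α := Real.sq_sqrt hα.le
  obtain ⟨j₁, h₁⟩ := exists_int_mul_sub_sq_le (Real.sqrt_pos.2 hα) z.1
  obtain ⟨j₂, h₂⟩ := exists_int_mul_sub_sq_le (Real.sqrt_pos.2 hα) z.2
  rw [hsq] at h₁ h₂
  have hs' := (Equiv.subLeft ((j₁, j₂) : ℤ × ℤ)).summable_iff.2 hs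
  have ht := (Equiv.subLeft ((j₁, j₂) : ℤ × ℤ)).tsum_eq
    fun k : ℤ × ℤ => Real.exp (-(Real.pi * α / 4) * ((k.1 : ℝ) ^ 2 + (k.2 : ℝ) ^ 2))
  rw [← ht]
  refine le_trans ?_ (mul_le_mul_of_nonneg_left (mul_le_mul_of_nonneg_left
    (hs'.sum_le_tsum F fun _ _ => (Real.exp_pos _).le) (Real.exp_pos _).le) (by positivity))
  rw [Finset.mul_sum, Finset.mul_sum]
  refine Finset.sum_le_sum fun k _ => ?_
  rw [norm_inner_shift_gauss_shift_gauss]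
  refine mul_le_mul_of_nonneg_left ?_ (by positivity)
  rw [← Real.exp_add]
  refine Real.exp_le_exp.2 ?_
  have h3 := h₁ k.1
  have h4 := h₂ k.2
  simp only [Equiv.subLeft_apply, Prod.fst_sub, Prod.snd_sub, ptD] at h3 h4 ⊢
  have := Real.pi_pos
  nlinarith

lemma summable_norm_inner_shift_gauss_coh {α : ℝ} (hα : 0 < α) (ζ : ℂ) :
    Summable fun k => ‖inner ℂ (shift (ptD α k) gauss) (coh ζ)‖ := by
  obtain ⟨C, hC⟩ := exists_sum_norm_inner_shift_gauss_le hα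
  have h := summable_of_sum_le (fun _ => norm_nonneg _) (hC (-ζ.re, ζ.im))
  -- `coh ζ` is a nonzero multiple of the Gaussian shifted by `(-Re ζ, Im ζ)`.
  simp only [shift_gauss (-ζ.re, ζ.im), inner_smul_right, norm_mul] at h
  rw [summable_mul_left_iff (by simp)] at h
  refine h.congr fun k => ?_
  congr 3
  push_cast
  rw [neg_neg, re_add_im]

lemma sum_norm_le_of_hasSum {ι κ E : Type*} [NormedAddCommGroup E] [NormedSpace ℂ E]
    {L : κ → E →L[ℂ] ℂ} (F : Finset κ) {d : ι → ℂ} {y : ι → E} {x : E} {m : ℝ}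
    (h : HasSum (fun l => d l • y l) x) (hd : Summable fun l => ‖d l‖) (hm : 0 ≤ m)
    (hy : ∀ l, ∑ k ∈ F, ‖L k (y l)‖ ≤ m) : ∑ k ∈ F, ‖L k x‖ ≤ (∑' l, ‖d l‖) * m := by
  have hc : Continuous fun v => ∑ k ∈ F, ‖L k v‖ := by fun_prop
  refine le_of_tendsto ((hc.tendsto x).comp h) (Filter.Eventually.of_forall fun s => ?_)
  calc ∑ k ∈ F, ‖L k (∑ l ∈ s, d l • y l)‖ ≤ ∑ k ∈ F, ∑ l ∈ s, ‖d l‖ * ‖L k (y l)‖ := by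
        refine Finset.sum_le_sum fun k _ => ?_
        rw [map_sum]
        refine (norm_sum_le _ _).trans_eq (Finset.sum_congr rfl fun l _ => ?_)
        rw [map_smul, norm_smul]
    _ = ∑ l ∈ s, ‖d l‖ * ∑ k ∈ F, ‖L k (y l)‖ := by
        rw [Finset.sum_comm]
        simp only [Finset.mul_sum]
    _ ≤ ∑ l ∈ s, ‖d l‖ * m :=
        Finset.sum_le_sum fun l _ => mul_le_mul_of_nonneg_left (hy l) (norm_nonneg _)
    _ ≤ (∑' l, ‖d l‖) * m := by
        rw [← Finset.sum_mul]
        exact mul_le_mul_of_nonneg_right (hd.sum_le_tsum s fun _ _ => norm_nonneg _) hm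

/-- For a finite set `F`, let `M` be the supremum over all translates `z` of the partial sum `Φ z`.
The equation for `dualGauss` gives `M ≤ √2 C + ρ M` with `ρ < 1`, so `M ≤ √2 C / (1 - ρ)`
independently of `F`. All translates must be treated at once because the defect moves `z` along
`D^⊥`. -/
lemma summable_norm_inner_shift_gauss_dualGauss {α : ℝ} (hα : 0 < α) (h : α ≤ 0.948) :
    Summable fun k => ‖inner ℂ (shift (ptD α k) gauss) (dualGauss α)‖ := by
  obtain ⟨C, hC⟩ := exists_sum_norm_inner_shift_gauss_le hα
  set ρ := ∑' k, ‖defectCoeff α k‖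
  have hρ1 : ρ < 1 := tsum_norm_defectCoeff_lt_one hα h
  refine summable_of_sum_le (c := √2 * C / (1 - ρ)) (fun _ => norm_nonneg _) fun F => ?_
  set Φ : ℝ × ℝ → ℝ := fun z =>
    ∑ k ∈ F, ‖inner ℂ (shift (ptD α k) gauss) (shift z (dualGauss α))‖ with hΦ
  -- Finiteness of the supremum, which depends on `F` here, is what allows `ρ M` to be absorbed
  -- later.
  have hbdd : BddAbove (Set.range Φ) := by
    refine ⟨∑ k ∈ F, ‖gauss‖ * ‖dualGauss α‖, ?_⟩
    rintro _ ⟨z, rfl⟩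
    refine Finset.sum_le_sum fun k _ => (norm_inner_le_norm _ _).trans ?_
    rw [norm_shift_apply, norm_shift_apply]
  have hle : ∀ z, Φ z ≤ ⨆ z, Φ z := fun z => le_ciSup hbdd z
  have hd : ∀ z, ∑ k ∈ F, ‖inner ℂ (shift (ptD α k) gauss) (shift z (defect α (dualGauss α)))‖ ≤
      ρ * ⨆ z, Φ z := fun z => by
    refine sum_norm_le_of_hasSum (L := fun k => (innerSL ℂ (shift (ptD α k) gauss)).comp (shift z))
      F (hasSum_defect_apply hα (dualGauss α)) (summable_norm_defectCoeff hα)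
      ((Finset.sum_nonneg fun _ _ => norm_nonneg _).trans (hle 0)) fun l => ?_
    refine le_trans (le_of_eq (Finset.sum_congr rfl fun k _ => ?_)) (hle (z - ptDperp α l))
    exact norm_inner_shift_star_shift _ _ _ _
  have hsup : ⨆ z, Φ z ≤ √2 * C / (1 - ρ) := by
    have h1 : ⨆ z, Φ z ≤ √2 * C + ρ * ⨆ z, Φ z := by
      refine ciSup_le fun z => ?_
      have h2 : Φ z ≤ ∑ k ∈ F, (√2 * ‖inner ℂ (shift (ptD α k) gauss) (shift z gauss)‖ +
          ‖inner ℂ (shift (ptD α k) gauss) (shift z (defect α (dualGauss α)))‖) := by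
        refine Finset.sum_le_sum fun k _ => ?_
        conv_lhs => rw [dualGauss_eq hα h]
        rw [map_add, inner_add_right, map_smul, inner_smul_right]
        refine (norm_add_le _ _).trans_eq ?_
        rw [norm_mul, norm_real, Real.norm_of_nonneg (Real.sqrt_nonneg _)]
      rw [Finset.sum_add_distrib, ← Finset.mul_sum] at h2
      have := mul_le_mul_of_nonneg_left (hC z F) (Real.sqrt_nonneg 2)
      linarith [hd z]
    rw [le_div_iff₀ (by linarith)]
    linarith
  refine le_trans (le_of_eq ?_) ((hle 0).trans hsup)
  simp only [hΦ, shift_zero]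
  rfl

/-! ### The frame expansion of the Gaussian -/

lemma summable_smul_shift_gauss {α : ℝ} {c : ℤ × ℤ → ℂ} (hc : Summable fun k => ‖c k‖) :
    Summable fun k => c k • shift (ptD α k) gauss := by
  refine Summable.of_norm_bounded (hc.mul_right ‖gauss‖) fun k => ?_
  rw [norm_smul, norm_shift_apply]

lemma hasSum_smul_shift_gauss_mem {α : ℝ} {c : ℤ × ℤ → ℂ} {x : L2}
    (h : HasSum (fun k => c k • shift (ptD α k) gauss) x) : x ∈ cohSpan :=
  mem_of_hasSum isClosed_cohSpan h fun _ => cohSpan.smul_mem _ (shift_mem _ _ gauss_mem)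

lemma hasSum_inner_smul_shift_gauss {α : ℝ} {c : ℤ × ℤ → ℂ} {x : L2}
    (h : HasSum (fun k => c k • shift (ptD α k) gauss) x) (y : L2) :
    HasSum (fun k => c k * inner ℂ y (shift (ptD α k) gauss)) (inner ℂ y x) := by
  simpa [inner_smul_right] using (innerSL ℂ y).hasSum h

lemma hasSum_inner_smul_shift_gauss_left {α : ℝ} {c : ℤ × ℤ → ℂ} {x : L2}
    (h : HasSum (fun k => c k • shift (ptD α k) gauss) x) (y : L2) :
    HasSum (fun k => conj (c k) * inner ℂ (shift (ptD α k) gauss) y) (inner ℂ x y) := by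
  have h1 := Complex.conjCLE.toContinuousLinearMap.hasSum (hasSum_inner_smul_shift_gauss h y)
  simpa [inner_conj_symm] using h1

/-- The frame operator on coherent states. -/
lemma hasSum_frame_coh {α : ℝ} (hα : 0 < α) (ζ : ℂ) :
    HasSum (fun k => inner ℂ (shift (ptD α k) gauss) (coh ζ) • shift (ptD α k) gauss)
      ((1 / α : ℂ) • opA α (coh ζ)) := by
  have h := (summable_smul_shift_gauss (α := α) (summable_norm_inner_shift_gauss_coh hα ζ)).hasSum
  rwa [eq_of_forall_inner_coh_eq (hasSum_smul_shift_gauss_mem h)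
    (cohSpan.smul_mem (1 / α : ℂ) (opA_mem hα _ (coh_mem ζ))) fun ω => ?_] at h
  rw [inner_smul_right]
  exact (hasSum_inner_smul_shift_gauss h (coh ω)).unique (hasSum_janssen_coh hα ζ ω)

lemma inner_opA_left {α : ℝ} (hα : 0 < α) (x y : L2) :
    inner ℂ (opA α x) y = inner ℂ x (opA α y) := by
  have h : ContinuousLinearMap.adjoint (opA α) = opA α := isSelfAdjoint_opA hα
  rw [← ContinuousLinearMap.adjoint_inner_right, h]

/-- The expansion of the Gaussian `f` in the frame `π_w f`, `w ∈ D`. -/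
lemma hasSum_frame_dualGauss {α : ℝ} (hα : 0 < α) (h : α ≤ 0.948) :
    HasSum (fun k => inner ℂ (shift (ptD α k) gauss) (dualGauss α) • shift (ptD α k) gauss)
      ((1 / α : ℂ) • gauss) := by
  have h1 := (summable_smul_shift_gauss (α := α)
    (summable_norm_inner_shift_gauss_dualGauss hα h)).hasSum
  rwa [eq_of_forall_inner_coh_eq (hasSum_smul_shift_gauss_mem h1)
    (cohSpan.smul_mem (1 / α : ℂ) gauss_mem) fun ω => ?_] at h1
  have h2 := hasSum_inner_smul_shift_gauss h1 (coh ω)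
  -- The frame sum is symmetric: tested against `coh ω`, it becomes the frame sum of `coh ω` tested
  -- against `dualGauss`, where Janssen's identity applies and `a` moves across to cancel `a⁻¹`.
  have h3 := hasSum_inner_smul_shift_gauss_left (hasSum_frame_coh hα ω) (dualGauss α)
  simp only [inner_conj_symm] at h3
  rw [inner_smul_left, inner_opA_left hα, opA_dualGauss hα h] at h3
  rw [inner_smul_right]
  refine (h2.unique (by simpa only [mul_comm] using h3)).trans ?_
  simp [mul_comm]

/-! ### The coefficients of the projection -/

/-- The coefficients `α ⟨a⁻¹ f, π_w f⟩` of the projection. -/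
def projCoeff (α : ℝ) (k : ℤ × ℤ) : ℂ :=
  α * inner ℂ (shift (ptD α k) gauss) (dualGauss α)

lemma summable_norm_projCoeff {α : ℝ} (hα : 0 < α) (h : α ≤ 0.948) :
    Summable fun k => ‖projCoeff α k‖ := by
  simp only [projCoeff, norm_mul]
  exact (summable_norm_inner_shift_gauss_dualGauss hα h).mul_left _

/-- `a⁻¹` is self-adjoint and commutes with `π_w`; here this is read off from `f = a (a⁻¹ f)`. -/
lemma inner_shift_gauss_dualGauss {α : ℝ} (hα : 0 < α) (h : α ≤ 0.948) (k : ℤ × ℤ) :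
    inner ℂ (shift (ptD α k) gauss) (dualGauss α) =
      inner ℂ (shift (ptD α k) (dualGauss α)) gauss := by
  have h1 : shift (ptD α k) (opA α (dualGauss α)) = opA α (shift (ptD α k) (dualGauss α)) :=
    congrArg (fun T : L2 →L[ℂ] L2 => T (dualGauss α)) (commute_shift_opA hα k).eq
  rw [opA_dualGauss hα h] at h1
  rw [h1, inner_opA_left hα, opA_dualGauss hα h]

lemma ptD_mul_ptD {α : ℝ} (hα : 0 < α) (k l : ℤ × ℤ) :
    (ptD α k).1 * (ptD α l).2 = α * (k.1 * l.2) := by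
  have h : √α * √α = α := Real.mul_self_sqrt hα.le
  simp only [ptD]
  linear_combination (k.1 * l.2 : ℝ) * h

/-- Translation by `π_k` on the left of `π_l`, inside an inner product. -/
lemma inner_shift_ptD_shift_ptD {α : ℝ} (hα : 0 < α) (k l : ℤ × ℤ) (x y : L2) :
    inner ℂ (shift (ptD α l) x) (shift (ptD α k) y) =
      e (α * (k.1 * (l - k).2)) * inner ℂ (shift (ptD α (l - k)) x) y := by
  have h1 : shift (ptD α l) x =
      e (-(α * (k.1 * (l - k).2))) • shift (ptD α k) (shift (ptD α (l - k)) x) := by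
    change _ = e (-(α * (k.1 * (l - k).2))) • (shift (ptD α k) * shift (ptD α (l - k))) x
    rw [shift_mul, ptD_mul_ptD hα, ← ptD_add, add_sub_cancel, smul_apply, smul_smul, ← e_add,
      neg_add_cancel, e_zero, one_smul]
  rw [h1, inner_smul_left, conj_e, neg_neg, inner_shift_shift]

/-- The coefficients are idempotent for the twisted convolution. -/
lemma hasSum_projCoeff_conv {α : ℝ} (hα : 0 < α) (h : α ≤ 0.948) (l : ℤ × ℤ) :
    HasSum (fun k => projCoeff α k * projCoeff α (l - k) * e (α * (k.1 * (l - k).2)))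
      (projCoeff α l) := by
  -- Pairing the expansion of `f / α` with `π_l a⁻¹ f` produces `c_l` from the sum, while `⟨π_k f,
  -- π_l a⁻¹ f⟩` is `c_{l-k}` up to a phase and the factor `α`.
  have h1 := (hasSum_inner_smul_shift_gauss (hasSum_frame_dualGauss hα h)
    (shift (ptD α l) (dualGauss α))).mul_left ((α : ℂ) * α)
  have hα' : (α : ℂ) ≠ 0 := ofReal_ne_zero.2 hα.ne'
  rw [inner_smul_right, ← inner_shift_gauss_dualGauss hα h, mul_assoc, ← mul_assoc (α : ℂ) (1 / α),
    mul_one_div_cancel hα', one_mul] at h1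
  suffices h2 : (fun k => projCoeff α k * projCoeff α (l - k) * e (α * (k.1 * (l - k).2))) =
      fun k => α * α * (inner ℂ (shift (ptD α k) gauss) (dualGauss α) *
        inner ℂ (shift (ptD α l) (dualGauss α)) (shift (ptD α k) gauss)) from h2 ▸ h1
  funext k
  rw [inner_shift_ptD_shift_ptD hα, ← inner_shift_gauss_dualGauss hα h, projCoeff, projCoeff]
  ring

/-- The condition on the coefficients that makes the element self-adjoint. -/
lemma conj_projCoeff_neg {α : ℝ} (hα : 0 < α) (h : α ≤ 0.948) (k : ℤ × ℤ) :
    conj (projCoeff α (-k)) * e (α * (k.1 * k.2)) = projCoeff α k := by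
  have h1 : star (shift (ptD α (-k))) = e (α * (k.1 * k.2)) • shift (ptD α k) := by
    rw [star_shift, ptD_mul_ptD hα, ptD_neg, neg_neg]
    simp
  have h2 : inner ℂ (dualGauss α) (shift (ptD α (-k)) gauss) =
      inner ℂ (star (shift (ptD α (-k))) (dualGauss α)) gauss := by
    rw [← inner_conj_symm, inner_shift_left, inner_conj_symm]
  rw [projCoeff, projCoeff, map_mul, conj_ofReal, inner_conj_symm, mul_assoc,
    inner_shift_gauss_dualGauss hα h, h2, h1, smul_apply, inner_smul_left, conj_e, mul_right_comm,
    ← e_add, neg_add_cancel, e_zero, one_mul]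

/-! ### The inverse square root of a positive operator -/

section invSqrt

variable {K : Type*} [NormedAddCommGroup K] [InnerProductSpace ℂ K] [CompleteSpace K]

lemma invSqrt_mul_self {a : K →L[ℂ] K} (h0 : 0 ≤ a) (ha : IsUnit a) :
    invSqrt a * invSqrt a = Ring.inverse a := by
  obtain ⟨a, rfl⟩ := ha
  rw [Ring.inverse_unit, ← CFC.rpow_neg_one_eq_inv a h0, invSqrt, ← CFC.rpow_add a.isUnit]
  norm_num

lemma commute_invSqrt {a s : K →L[ℂ] K} (h : Commute s a) : Commute s (invSqrt a) :=
  (Commute.cfc_nnreal h.symm _).symm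

lemma inner_invSqrt_left (a : K →L[ℂ] K) (x y : K) :
    inner ℂ (invSqrt a x) y = inner ℂ x (invSqrt a y) := by
  have h0 : 0 ≤ invSqrt a := CFC.rpow_nonneg
  have h : ContinuousLinearMap.adjoint (invSqrt a) = invSqrt a := IsSelfAdjoint.of_nonneg h0
  rw [← ContinuousLinearMap.adjoint_inner_right, h]

end invSqrt

lemma innerD_gaussTight {α : ℝ} (hα : 0 < α) (h : α ≤ 0.948) (k : ℤ × ℤ) :
    (α : ℂ) * innerD (gaussTight α) (gaussTight α) (ptD α k) = projCoeff α k := by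
  have h1 : shift (ptD α k) (invSqrt (opA α) gauss) = invSqrt (opA α) (shift (ptD α k) gauss) :=
    congrArg (fun T : L2 →L[ℂ] L2 => T gauss) (commute_invSqrt (commute_shift_opA hα k)).eq
  have h2 : invSqrt (opA α) (invSqrt (opA α) gauss) = dualGauss α :=
    congrArg (fun T : L2 →L[ℂ] L2 => T gauss) 
      (invSqrt_mul_self (opA_nonneg hα h) (isUnit_opA hα h))
  rw [projCoeff, innerD, gaussTight, h1, inner_invSqrt_left, h2]

/-! ### Invariance of the coefficients under the Fourier rotation -/

/-- The quarter turn `(x, y) ↦ (-y, x)`. -/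
def turn {R : Type*} [Neg R] (w : R × R) : R × R := (-w.2, w.1)

/-- The graph of the Fourier transform on coherent states. -/
def fourierGraph : Submodule ℂ (L2 × L2) :=
  (Submodule.span ℂ (Set.range fun ζ : ℂ =>
    (coh ζ, cexp (Real.pi * ζ ^ 2) • coh (-I * ζ)))).topologicalClosure

lemma isClosed_fourierGraph : IsClosed (fourierGraph : Set (L2 × L2)) :=
  Submodule.isClosed_topologicalClosure _

lemma coh_mem_fourierGraph (ζ : ℂ) :
    (coh ζ, cexp (Real.pi * ζ ^ 2) • coh (-I * ζ)) ∈ fourierGraph :=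
  Submodule.le_topologicalClosure _ (Submodule.subset_span ⟨ζ, rfl⟩)

lemma gauss_mem_fourierGraph : (gauss, gauss) ∈ fourierGraph := by
  have h := coh_mem_fourierGraph 0
  simpa [coh_zero] using h

/-- The Fourier transform sends `coh ζ` to `exp(π ζ²) coh(-iζ)`. This is its intertwining relation
with `π_w` on such vectors: conjugation turns `w` by a right angle, up to the phase `e(-w' w'')`. -/
lemma e_smul_shift_turn_coh (w : ℝ × ℝ) (ζ : ℂ) :
    e (-(w.1 * w.2)) • shift (turn w) (cexp (Real.pi * ζ ^ 2) • coh (-I * ζ)) =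
      cexp (-Real.pi * w.1 ^ 2 + 2 * Real.pi * ζ * w.1) •
        (cexp (Real.pi * (ζ - w.1 + w.2 * I) ^ 2) • coh (-I * (ζ - w.1 + w.2 * I))) := by
  rw [map_smul, shift_coh, e, smul_smul, smul_smul, smul_smul, ← Complex.exp_add,
    ← Complex.exp_add, ← Complex.exp_add]
  congr 2
  · simp only [turn]
    push_cast
    linear_combination (Real.pi * (w.2 : ℂ) ^ 2 * (-1 : ℂ)) * I_sq
  · simp only [turn]
    push_cast
    linear_combination (w.2 : ℂ) * I_sq

lemma shift_mem_fourierGraph (w : ℝ × ℝ) : ∀ p ∈ fourierGraph,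
    (shift w p.1, e (-(w.1 * w.2)) • shift (turn w) p.2) ∈ fourierGraph := by
  refine map_mem_of_mem_closure_span isClosed_fourierGraph
    ((shift w).prodMap (e (-(w.1 * w.2)) • shift (turn w))) ?_
  rintro _ ⟨ζ, rfl⟩
  have h : ((shift w).prodMap (e (-(w.1 * w.2)) • shift (turn w)))
      (coh ζ, cexp (Real.pi * ζ ^ 2) • coh (-I * ζ)) =
      cexp (-Real.pi * w.1 ^ 2 + 2 * Real.pi * ζ * w.1) • (coh (ζ - w.1 + w.2 * I),
        cexp (Real.pi * (ζ - w.1 + w.2 * I) ^ 2) • coh (-I * (ζ - w.1 + w.2 * I))) :=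
    Prod.ext (shift_coh w ζ) (e_smul_shift_turn_coh w ζ)
  simp only [h]
  exact fourierGraph.smul_mem _ (coh_mem_fourierGraph _)

lemma star_shift_mem_fourierGraph (w : ℝ × ℝ) (p : L2 × L2) (hp : p ∈ fourierGraph) :
    (star (shift w) p.1, e (w.1 * w.2) • star (shift (turn w)) p.2) ∈ fourierGraph := by
  have h := fourierGraph.smul_mem (e (w.1 * w.2)) (shift_mem_fourierGraph (-w) p hp)
  have h1 : turn (-w) = -turn w := by simp [turn]
  have h2 : (turn w).1 * (turn w).2 = -((-w).1 * (-w).2) := by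
    simp only [turn, Prod.fst_neg, Prod.snd_neg]
    ring
  rw [star_shift, star_shift, smul_apply, smul_apply, h2, ← h1]
  exact h

lemma turn_ptDperp (α : ℝ) (k : ℤ × ℤ) : turn (ptDperp α k) = ptDperp α (k.2, -k.1) := by
  simp [turn, ptDperp, neg_div]

lemma turn_ptD (α : ℝ) (k : ℤ × ℤ) : turn (ptD α k) = ptD α (turn k) := by
  simp [turn, ptD]

/-- The coefficient is a radial function times `exp(-π i w' w'')`, and the turn changes the sign of
`w' w''`. -/
lemma innerDperp_gauss_turn (w : ℝ × ℝ) :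
    innerDperp gauss gauss (turn w) = innerDperp gauss gauss w * e (w.1 * w.2) := by
  rw [innerDperp, innerDperp, inner_shift_gauss, inner_shift_gauss, e, ← Complex.exp_add,
    ← Complex.exp_add, mul_assoc ((1 / √2 : ℝ) : ℂ), ← Complex.exp_add]
  congr 2
  simp only [turn]
  push_cast
  ring

/-- The quarter turn of `ℤ²` matching the one of `D^⊥`. -/
def turnEquiv : ℤ × ℤ ≃ ℤ × ℤ where
  toFun k := (k.2, -k.1)
  invFun k := (-k.2, k.1)
  left_inv k := by simp
  right_inv k := by simp

lemma defectCoeff_turn (α : ℝ) (k : ℤ × ℤ) : defectCoeff α (turnEquiv k) =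
    defectCoeff α k * e ((ptDperp α k).1 * (ptDperp α k).2) := by
  have h0 : turnEquiv k = 0 ↔ k = 0 := by
    simp [turnEquiv, Prod.ext_iff, and_comm]
  have h1 : ptDperp α (turnEquiv k) = turn (ptDperp α k) := (turn_ptDperp α k).symm
  by_cases hk : k = 0
  · rw [defectCoeff, defectCoeff, if_pos (h0.2 hk), if_pos hk, zero_mul]
  · rw [defectCoeff, defectCoeff, if_neg (mt h0.1 hk), if_neg hk, h1, innerDperp_gauss_turn]
    ring

/-- The defect commutes with the Fourier transform: after reindexing the second component by the
quarter turn, the phase of the coefficient matches that of the turned shift. -/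
lemma defect_mem_fourierGraph {α : ℝ} (hα : 0 < α) (p : L2 × L2) (hp : p ∈ fourierGraph) :
    (defect α p.1, defect α p.2) ∈ fourierGraph := by
  have h1 := hasSum_defect_apply hα p.1
  have h2 := turnEquiv.hasSum_iff.2 (hasSum_defect_apply hα p.2)
  refine mem_of_hasSum isClosed_fourierGraph (h1.prodMk h2) fun k => ?_
  have h3 := fourierGraph.smul_mem (defectCoeff α k)
    (star_shift_mem_fourierGraph (ptDperp α k) p hp)
  convert h3 using 1
  refine Prod.ext rfl ?_
  rw [Function.comp_apply, defectCoeff_turn, Prod.smul_snd, smul_smul,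
    show ptDperp α (turnEquiv k) = turn (ptDperp α k) from (turn_ptDperp α k).symm]

/-- Both components solve the same fixed-point equation, and the pair `(f, f)` is in the graph. The
sup norm on the product keeps `defect × defect` a strict contraction. -/
lemma dualGauss_mem_fourierGraph {α : ℝ} (hα : 0 < α) (h : α ≤ 0.948) :
    (dualGauss α, dualGauss α) ∈ fourierGraph := by
  have h1 := dualGauss_eq hα h
  refine mem_of_eq_add_of_norm_lt_one isClosed_fourierGraph
    (T := (defect α).prodMap (defect α)) (lt_of_le_of_lt ?_ (norm_defect_lt_one hα h))
    (defect_mem_fourierGraph hα) (fourierGraph.smul_mem (√2 : ℂ) gauss_mem_fourierGraph)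
    (Prod.ext h1 h1)
  refine ContinuousLinearMap.opNorm_le_bound _ (norm_nonneg _) fun p => ?_
  exact norm_prod_le_iff.2
    ⟨((defect α).le_opNorm p.1).trans (by gcongr; exact norm_fst_le p),
      ((defect α).le_opNorm p.2).trans (by gcongr; exact norm_snd_le p)⟩

/-- Plancherel's identity on coherent states. -/
lemma inner_coh_rotate (ζ ω : ℂ) :
    inner ℂ (cexp (Real.pi * ζ ^ 2) • coh (-I * ζ)) (cexp (Real.pi * ω ^ 2) • coh (-I * ω)) =
      inner ℂ (coh ζ) (coh ω) := by
  rw [inner_smul_left, inner_smul_right, inner_coh, inner_coh, mul_left_comm (cexp _),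
    mul_left_comm (conj _), ← Complex.exp_conj, ← Complex.exp_add, ← Complex.exp_add]
  congr 2
  simp only [map_mul, map_neg, map_pow, conj_ofReal, conj_I]
  linear_combination (Real.pi / 2 * (conj ζ - ω) ^ 2 : ℂ) * I_sq

lemma projCoeff_turn {α : ℝ} (hα : 0 < α) (h : α ≤ 0.948) (k : ℤ × ℤ) :
    projCoeff α k = e (α * (k.1 * k.2)) * projCoeff α (turn k) := by
  set w := ptD α k with hw
  have h1 : e (-(w.1 * w.2)) • shift (turn w) gauss = cexp (-Real.pi * w.1 ^ 2) •
      (cexp (Real.pi * (-w.1 + w.2 * I) ^ 2) • coh (-I * (-w.1 + w.2 * I))) := by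
    have := e_smul_shift_turn_coh w 0
    simpa [coh_zero] using this
  -- The functional `⟨x, π_w f⟩ - ⟨y, F π_w f⟩` of the pair `(x, y)`, `F` being the Fourier
  -- transform, vanishes on the graph by Plancherel; it is evaluated at `(a⁻¹ f, a⁻¹ f)`.
  have h2 := map_eq_zero_of_mem_closure_span
    ((innerSL ℂ (shift w gauss)).comp (ContinuousLinearMap.fst ℂ L2 L2) -
      (innerSL ℂ (e (-(w.1 * w.2)) • shift (turn w) gauss)).comp
        (ContinuousLinearMap.snd ℂ L2 L2)) (by
    rintro _ ⟨ω, rfl⟩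
    change inner ℂ (shift w gauss) (coh ω) - inner ℂ (e (-(w.1 * w.2)) • shift (turn w) gauss)
      (cexp (Real.pi * ω ^ 2) • coh (-I * ω)) = 0
    rw [h1, shift_gauss, inner_smul_left, inner_smul_left _ _ (cexp (-Real.pi * w.1 ^ 2)),
      inner_coh_rotate, sub_self]) _ (dualGauss_mem_fourierGraph hα h)
  have h3 : inner ℂ (shift w gauss) (dualGauss α) -
    inner ℂ (e (-(w.1 * w.2)) • shift (turn w) gauss) (dualGauss α) = 0 := h2
  rw [sub_eq_zero, inner_smul_left, conj_e, neg_neg, hw, ptD_mul_ptD hα, turn_ptD] at h3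
  rw [projCoeff, projCoeff, h3]
  ring

/-! ### The trace of the projection -/

lemma e_nat_mul (n : ℕ) (t : ℝ) : e (n * t) = e t ^ n := by
  unfold e
  rw [← Complex.exp_nat_mul]
  congr 1
  push_cast
  ring

lemma sum_e_div_eq_zero {m : ℤ} {N : ℕ} (hm : m ≠ 0) (hN : m.natAbs < N) :
    ∑ j ∈ Finset.range N, e (j * (m / N)) = 0 := by
  have hN0 : (N : ℝ) ≠ 0 := by
    have : N ≠ 0 := by omega
    exact_mod_cast this
  simp only [e_nat_mul]
  have h1 : e (m / N) ^ N = 1 := by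
    rw [← e_nat_mul, mul_div_cancel₀ _ hN0, e_int]
  have h2 : e (m / N) ≠ 1 := by
    intro h
    unfold e at h
    obtain ⟨n, hn⟩ := Complex.exp_eq_one_iff.1 h
    have h3 : ((m / N : ℝ) : ℂ) = n := by
      have hne : (2 * Real.pi * I : ℂ) ≠ 0 := by simp [Real.pi_ne_zero]
      refine mul_left_cancel₀ hne (hn.trans ?_)
      ring
    have h4 : (m / N : ℝ) = n := by exact_mod_cast h3
    rw [div_eq_iff hN0] at h4
    have h5 : m = n * N := by exact_mod_cast h4
    have h6 : (N : ℤ) ∣ m := ⟨n, by rw [h5, mul_comm]⟩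
    exact hm (Int.eq_zero_of_abs_lt_dvd h6 (by rw [Int.abs_eq_natAbs]; omega))
  rw [geom_sum_eq h2, h1, sub_self, zero_div]

/-- The average of the vector states of `π_w f`, for `w` in a period of the refined lattice
`N⁻¹ D`. -/
def latticeAvg (α : ℝ) (N : ℕ) : (L2 →L[ℂ] L2) →L[ℂ] ℂ :=
  ((√2 / N ^ 2 : ℝ) : ℂ) • ∑ k ∈ Finset.range N ×ˢ Finset.range N,
    (innerSL ℂ (shift (k.1 * (√α / N), k.2 * (√α / N)) gauss)).comp
      (ContinuousLinearMap.apply ℂ L2 (shift (k.1 * (√α / N), k.2 * (√α / N)) gauss))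

lemma latticeAvg_apply (α : ℝ) (N : ℕ) (T : L2 →L[ℂ] L2) :
    latticeAvg α N T = ((√2 / N ^ 2 : ℝ) : ℂ) * ∑ k ∈ Finset.range N ×ˢ Finset.range N,
      inner ℂ (shift (k.1 * (√α / N), k.2 * (√α / N)) gauss)
        (T (shift (k.1 * (√α / N), k.2 * (√α / N)) gauss)) := by
  rw [latticeAvg, smul_apply, smul_eq_mul, sum_apply]
  rfl

/-- Explains the factor `√2` in `latticeAvg`, which makes its value at `1` equal to `1`. -/
lemma norm_sq_gauss : ‖gauss‖ ^ 2 = 1 / √2 := by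
  have h := inner_shift_gauss 0
  rw [shift_zero] at h
  have h2 : (inner ℂ gauss gauss : ℂ) = (1 / √2 : ℝ) := by simpa using h
  rw [inner_self_eq_norm_sq_to_K] at h2
  exact Complex.ofReal_injective (by rw [← h2, ofReal_pow]; rfl)

lemma norm_latticeAvg_apply_le (α : ℝ) (N : ℕ) (T : L2 →L[ℂ] L2) : ‖latticeAvg α N T‖ ≤ ‖T‖ := by
  rw [latticeAvg_apply, norm_mul, norm_real, Real.norm_of_nonneg (by positivity)]
  have h : ∀ w, ‖inner ℂ (shift w gauss) (T (shift w gauss))‖ ≤ ‖T‖ * (1 / √2) := fun w => by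
    refine (norm_inner_le_norm _ _).trans ?_
    rw [← norm_sq_gauss, norm_shift_apply]
    have := T.le_opNorm (shift w gauss)
    rw [norm_shift_apply] at this
    nlinarith [norm_nonneg gauss]
  refine (mul_le_mul_of_nonneg_left (norm_sum_le_of_le _ fun k _ => h _) (by positivity)).trans ?_
  rw [Finset.sum_const, Finset.card_product, Finset.card_range, nsmul_eq_mul]
  rcases eq_or_ne N 0 with rfl | hN
  · simp
  · have : (N : ℝ) ≠ 0 := by exact_mod_cast hN
    have h2 : √2 ≠ 0 := by positivity
    push_cast
    refine le_of_eq ?_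
    field_simp

lemma latticeAvg_one (α : ℝ) {N : ℕ} (hN : N ≠ 0) : latticeAvg α N 1 = 1 := by
  have h : ∀ w, inner ℂ (shift w gauss) ((1 : L2 →L[ℂ] L2) (shift w gauss)) =
      ((1 / √2 : ℝ) : ℂ) := fun w => by
    rw [one_apply_eq_self, inner_shift_shift, inner_self_eq_norm_sq_to_K, ← norm_sq_gauss]
    norm_cast
  have hN' : (N : ℝ) ≠ 0 := by exact_mod_cast hN
  have h2 : √2 ≠ 0 := by positivity
  simp only [latticeAvg_apply, h]
  rw [Finset.sum_const, Finset.card_product, Finset.card_range, nsmul_eq_mul]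
  norm_cast
  field_simp
  rw [sq]

lemma inner_shift_shift_shift (w z : ℝ × ℝ) (x y : L2) :
    inner ℂ (shift w x) (shift z (shift w y)) =
      e (z.1 * w.2 - w.1 * z.2) * inner ℂ x (shift z y) := by
  have h : shift z (shift w y) = e (z.1 * w.2 - w.1 * z.2) • shift w (shift z y) := by
    change (shift z * shift w) y = e (z.1 * w.2 - w.1 * z.2) • (shift w * shift z) y
    rw [shift_mul, shift_mul, smul_apply, smul_apply, smul_smul, ← e_add, sub_add_cancel,
      add_comm]
  rw [h, inner_smul_right, inner_shift_shift]

/-- Conjugating `π_z`, `z ∈ D^⊥`, by a point of the refined grid multiplies it by a character of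
`(ℤ/N)²`. It is nontrivial once `N` exceeds the entries of `k`, so its average vanishes. -/
lemma latticeAvg_shift_eq_zero {α : ℝ} (hα : 0 < α) {k : ℤ × ℤ} (hk : k ≠ 0) {N : ℕ}
    (h1 : k.1.natAbs < N) (h2 : k.2.natAbs < N) : latticeAvg α N (shift (ptDperp α k)) = 0 := by
  have hs : √α ≠ 0 := (Real.sqrt_pos.2 hα).ne'
  have h : ∀ i j : ℕ, inner ℂ (shift (i * (√α / N), j * (√α / N)) gauss)
      (shift (ptDperp α k) (shift (i * (√α / N), j * (√α / N)) gauss)) =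
      inner ℂ gauss (shift (ptDperp α k) gauss) *
        (e (i * ((-k.1 : ℤ) / N)) * e (j * (k.2 / N))) := fun i j => by
    rw [inner_shift_shift_shift, ← e_add, mul_comm]
    congr 2
    simp only [ptDperp]
    push_cast
    field_simp
    ring
  rw [latticeAvg_apply, Finset.sum_product]
  simp only [h, ← Finset.mul_sum]
  rw [← Finset.sum_mul]
  have h0 : k.1 ≠ 0 ∨ k.2 ≠ 0 := by
    by_contra! hc
    exact hk (Prod.ext hc.1 hc.2)
  rcases h0 with h0 | h0
  · rw [sum_e_div_eq_zero (neg_ne_zero.2 h0) (by simpa using h1)]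
    simp
  · rw [sum_e_div_eq_zero h0 h2]
    simp

lemma star_shift_mul_shift (w z : ℝ × ℝ) :
    star (shift w) * shift z = e (w.1 * w.2 - w.1 * z.2) • shift (z - w) := by
  rw [star_shift, smul_mul_assoc, shift_mul, smul_smul, ← e_add, neg_add_eq_sub, Prod.fst_neg,
    neg_mul, sub_eq_add_neg (w.1 * w.2)]

lemma tendsto_latticeAvg_star_shift_mul_shift {α : ℝ} (hα : 0 < α) (k l : ℤ × ℤ) :
    Tendsto (fun N => latticeAvg α N (star (shift (ptDperp α k)) * shift (ptDperp α l))) atTop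
      (𝓝 (if k = l then 1 else 0)) := by
  by_cases hkl : k = l
  · subst hkl
    rw [star_shift_mul_self, if_pos rfl]
    refine tendsto_const_nhds.congr' ?_
    filter_upwards [eventually_ne_atTop 0] with N hN
    rw [latticeAvg_one α hN]
  · rw [if_neg hkl]
    refine tendsto_const_nhds.congr' ?_
    filter_upwards [eventually_gt_atTop (l - k).1.natAbs,
      eventually_gt_atTop (l - k).2.natAbs] with N h1 h2
    have h3 : ptDperp α l - ptDperp α k = ptDperp α (l - k) := by
      rw [sub_eq_add_neg, sub_eq_add_neg, ptDperp_add, ptDperp_neg]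
    rw [star_shift_mul_shift, map_smul, h3,
      latticeAvg_shift_eq_zero hα (sub_ne_zero.2 (Ne.symm hkl)) h1 h2, smul_zero]

/-- The limit is orthonormal on the shifts by `D^⊥`, so it extracts from `a` the coefficient at `l`.
The absolutely summable coefficients of `a` dominate the exchange of limit and sum. -/
lemma tendsto_latticeAvg_opA_mul_shift {α : ℝ} (hα : 0 < α) (l : ℤ × ℤ) :
    Tendsto (fun N => latticeAvg α N (opA α * shift (ptDperp α l))) atTop
      (𝓝 (inner ℂ gauss (shift (ptDperp α l) gauss))) := by
  have h1 : ∀ N, HasSum (fun k => innerDperp gauss gauss (ptDperp α k) *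
      latticeAvg α N (star (shift (ptDperp α k)) * shift (ptDperp α l)))
      (latticeAvg α N (opA α * shift (ptDperp α l))) := fun N => by
    have := (latticeAvg α N).hasSum ((hasSum_opA hα).mul_right (shift (ptDperp α l)))
    simpa [smul_mul_assoc] using this
  have h2 := tendsto_tsum_of_dominated_convergence (𝓕 := atTop)
    (f := fun N k => innerDperp gauss gauss (ptDperp α k) *
      latticeAvg α N (star (shift (ptDperp α k)) * shift (ptDperp α l)))
    (g := fun k => innerDperp gauss gauss (ptDperp α k) * if k = l then 1 else 0)
    (summable_norm_innerDperp_gauss hα)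
    (fun k => (tendsto_latticeAvg_star_shift_mul_shift hα k l).const_mul _)
    (Eventually.of_forall fun N k => by
      rw [norm_mul]
      refine mul_le_of_le_one_right (norm_nonneg _) ((norm_latticeAvg_apply_le _ _ _).trans ?_)
      rw [star_shift_mul_shift, norm_smul, norm_e, one_mul]
      exact norm_shift_le _)
  simp only [(h1 _).tsum_eq] at h2
  simpa [innerDperp] using h2

lemma tendsto_of_mem_closure_span {E : Type*} [NormedAddCommGroup E] [NormedSpace ℂ E]
    {Λ : ℕ → E →L[ℂ] ℂ} {M : ℝ} (hM : ∀ N x, ‖Λ N x‖ ≤ M * ‖x‖) {s : Set E}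
    (h : ∀ x ∈ s, Tendsto (fun N => Λ N x) atTop (𝓝 0)) :
    ∀ x ∈ (Submodule.span ℂ s).topologicalClosure, Tendsto (fun N => Λ N x) atTop (𝓝 0) := by
  have hspan : ∀ x ∈ Submodule.span ℂ s, Tendsto (fun N => Λ N x) atTop (𝓝 0) := by
    intro x hx
    induction hx using Submodule.span_induction with
    | mem x hx => exact h x hx
    | zero => simp
    | add x y _ _ hx hy => simpa using hx.add hy
    | smul c x _ hx => simpa using hx.const_mul c
  -- A strictly positive constant, to divide by in the `ε/2` argument.
  have hM0 : ∀ N x, ‖Λ N x‖ ≤ (|M| + 1) * ‖x‖ := fun N x =>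
    (hM N x).trans (mul_le_mul_of_nonneg_right ((le_abs_self M).trans (by simp)) (norm_nonneg x))
  intro x hx
  rw [Metric.tendsto_atTop]
  intro ε hε
  obtain ⟨y, hy, hxy⟩ := Metric.mem_closure_iff.1 hx (ε / 2 / (|M| + 1)) (by positivity)
  obtain ⟨N₀, hN₀⟩ := Metric.tendsto_atTop.1 (hspan y hy) (ε / 2) (by positivity)
  refine ⟨N₀, fun N hN => ?_⟩
  have h1 := hN₀ N hN
  rw [dist_zero_right] at h1 ⊢
  have h2 := hM0 N (x - y)
  rw [map_sub, ← dist_eq_norm x y] at h2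
  rw [lt_div_iff₀ (by positivity)] at hxy
  calc ‖Λ N x‖ = ‖(Λ N x - Λ N y) + Λ N y‖ := by rw [sub_add_cancel]
    _ ≤ ‖Λ N x - Λ N y‖ + ‖Λ N y‖ := norm_add_le _ _
    _ < ε := by nlinarith

/-- The closed linear span of the shifts by `D^⊥`. -/
def shiftSpan (α : ℝ) : Submodule ℂ (L2 →L[ℂ] L2) :=
  (Submodule.span ℂ (Set.range fun k => shift (ptDperp α k))).topologicalClosure

lemma isClosed_shiftSpan (α : ℝ) : IsClosed (shiftSpan α : Set (L2 →L[ℂ] L2)) :=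
  Submodule.isClosed_topologicalClosure _

lemma shift_mem_shiftSpan (α : ℝ) (k : ℤ × ℤ) : shift (ptDperp α k) ∈ shiftSpan α :=
  Submodule.le_topologicalClosure _ (Submodule.subset_span ⟨k, rfl⟩)

lemma star_shift_mul_mem_shiftSpan (α : ℝ) (k : ℤ × ℤ) :
    ∀ T ∈ shiftSpan α, star (shift (ptDperp α k)) * T ∈ shiftSpan α := by
  refine map_mem_of_mem_closure_span (isClosed_shiftSpan α)
    (ContinuousLinearMap.mul ℂ (L2 →L[ℂ] L2) (star (shift (ptDperp α k)))) ?_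
  rintro _ ⟨l, rfl⟩
  rw [ContinuousLinearMap.mul_apply', star_shift_mul_shift, sub_eq_add_neg (ptDperp α l),
    ← ptDperp_neg, ← ptDperp_add]
  exact (shiftSpan α).smul_mem _ (shift_mem_shiftSpan α _)

/-- `b = a⁻¹` satisfies `b = √2 + defect * b`, and left multiplication by the defect preserves the
closed span. -/
lemma inverse_opA_mem {α : ℝ} (hα : 0 < α) (h : α ≤ 0.948) :
    Ring.inverse (opA α) ∈ shiftSpan α := by
  refine mem_of_eq_add_of_norm_lt_one (isClosed_shiftSpan α)
    (T := ContinuousLinearMap.mul ℂ (L2 →L[ℂ] L2) (defect α)) (x₀ := (√2 : ℂ) • 1)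
    ((ContinuousLinearMap.opNorm_mul_apply_le ℂ _ _).trans_lt (norm_defect_lt_one hα h))
    (fun T hT => ?_) ?_ ?_
  · refine mem_of_hasSum (isClosed_shiftSpan α) ((hasSum_defect hα).mul_right T) fun k => ?_
    rw [smul_mul_assoc]
    exact (shiftSpan α).smul_mem _ (star_shift_mul_mem_shiftSpan α k T hT)
  · have := shift_mem_shiftSpan α 0
    rw [ptDperp_zero, shift_zero] at this
    exact (shiftSpan α).smul_mem _ this
  · rw [ContinuousLinearMap.mul_apply', defect, sub_mul, one_mul, smul_mul_assoc,
      Ring.mul_inverse_cancel _ (isUnit_opA hα h), add_sub_cancel]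

/-- The identity `tr(a T) = ⟨T f, f⟩` extends from the shifts to their closed span by uniform
boundedness; at `T = a⁻¹` its left side is `tr(1) = 1`. -/
lemma inner_gauss_dualGauss {α : ℝ} (hα : 0 < α) (h : α ≤ 0.948) :
    inner ℂ gauss (dualGauss α) = 1 := by
  have h1 := tendsto_of_mem_closure_span (Λ := fun N =>
    (latticeAvg α N).comp (ContinuousLinearMap.mul ℂ (L2 →L[ℂ] L2) (opA α)) -
      (innerSL ℂ gauss).comp (ContinuousLinearMap.apply ℂ L2 gauss))
    (M := ‖opA α‖ + ‖gauss‖ * ‖gauss‖) (fun N T => ?_) (s := Set.range fun k => shift (ptDperp α k))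
    (by
      rintro _ ⟨l, rfl⟩
      have := (tendsto_latticeAvg_opA_mul_shift hα l).sub_const
        (inner ℂ gauss (shift (ptDperp α l) gauss))
      rwa [sub_self] at this) _ (inverse_opA_mem hα h)
  · have h2 : ∀ N, ((latticeAvg α N).comp (ContinuousLinearMap.mul ℂ (L2 →L[ℂ] L2) (opA α)) -
      (innerSL ℂ gauss).comp (ContinuousLinearMap.apply ℂ L2 gauss)) (Ring.inverse (opA α)) =
        latticeAvg α N 1 - inner ℂ gauss (dualGauss α) := fun N => by
      rw [← Ring.mul_inverse_cancel _ (isUnit_opA hα h)]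
      rfl
    simp only [h2] at h1
    have h3 : Tendsto (fun N => latticeAvg α N 1 - inner ℂ gauss (dualGauss α)) atTop
        (𝓝 (1 - inner ℂ gauss (dualGauss α))) := by
      refine tendsto_const_nhds.congr' ?_
      filter_upwards [eventually_ne_atTop 0] with N hN
      rw [latticeAvg_one α hN]
    exact (sub_eq_zero.1 (tendsto_nhds_unique h3 h1)).symm
  · change ‖latticeAvg α N (opA α * T) - inner ℂ gauss (T gauss)‖ ≤ _
    refine (norm_sub_le _ _).trans ?_
    rw [add_mul]
    refine add_le_add ((norm_latticeAvg_apply_le _ _ _).trans (norm_mul_le _ _)) ?_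
    refine (norm_inner_le_norm _ _).trans ?_
    have := T.le_opNorm gauss
    nlinarith [norm_nonneg gauss]

lemma projCoeff_zero {α : ℝ} (hα : 0 < α) (h : α ≤ 0.948) : projCoeff α 0 = α := by
  rw [projCoeff, ptD_zero, shift_zero, one_apply_eq_self, inner_gauss_dualGauss hα h, mul_one]

/-! ### Weyl monomials in a C⋆-algebra -/

lemma zpow_mul_zpow_of_mul_eq {G : Type*} [Group G] {U V z : G} (hU : Commute z U)
    (hV : Commute z V) (h : U * V = z * (V * U)) (m n : ℤ) :
    U ^ m * V ^ n = z ^ (m * n) * (V ^ n * U ^ m) := by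
  have h1 : U * V * U⁻¹ = z * V := by rw [h]; group
  have h2 : U * V ^ n * U⁻¹ = z ^ n * V ^ n := by
    rw [← conj_zpow, h1, hV.mul_zpow]
  have h3 : (V ^ n)⁻¹ * U * ((V ^ n)⁻¹)⁻¹ = z ^ n * U := by
    have h4 : z ^ n * V ^ n = V ^ n * z ^ n := (hV.zpow_zpow n n).eq
    have h5 : U * V ^ n = V ^ n * (z ^ n * U) := by
      rw [← mul_assoc, ← h4, ← h2]; group
    rw [inv_inv, mul_assoc, h5, inv_mul_cancel_left]
  have h6 : (V ^ n)⁻¹ * U ^ m * ((V ^ n)⁻¹)⁻¹ = z ^ (m * n) * U ^ m := by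
    rw [← conj_zpow, h3, (hU.zpow_left n).mul_zpow, ← zpow_mul, mul_comm n m]
  have h7 : z ^ (m * n) * V ^ n = V ^ n * z ^ (m * n) := (hV.zpow_zpow _ n).eq
  rw [← mul_assoc, h7, mul_assoc, ← h6]
  group

section Weyl

variable {B : Type*} [CStarAlgebra B]

/-- The scalar unitary `e(t)`. -/
def scalarUnitary (B : Type*) [CStarAlgebra B] (t : ℝ) : unitary B :=
  ⟨e t • 1, by
    have h : star (e t) * e t = 1 := by
      rw [← starRingEnd_apply, conj_e, ← e_add, neg_add_cancel, e_zero]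
    refine Unitary.mem_iff.2 ⟨?_, ?_⟩
    · rw [star_smul, star_one, smul_mul_smul_comm, h, one_mul, one_smul]
    · rw [star_smul, star_one, smul_mul_smul_comm, mul_comm, h, one_mul, one_smul]⟩

lemma coe_scalarUnitary_mul (t : ℝ) (x : unitary B) :
    ((scalarUnitary B t * x : unitary B) : B) = e t • (x : B) := by
  change (e t • (1 : B)) * x = _
  rw [smul_mul_assoc, one_mul]

lemma commute_scalarUnitary (t : ℝ) (x : unitary B) : Commute (scalarUnitary B t) x :=
  Subtype.ext (by
    change (e t • (1 : B)) * x = x * (e t • (1 : B))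
    rw [smul_mul_assoc, one_mul, mul_smul_comm, mul_one])

lemma scalarUnitary_add (s t : ℝ) :
    scalarUnitary B (s + t) = scalarUnitary B s * scalarUnitary B t :=
  Subtype.ext (by
    rw [coe_scalarUnitary_mul]
    change e (s + t) • (1 : B) = e s • e t • (1 : B)
    rw [e_add, smul_smul])

lemma scalarUnitary_zpow (t : ℝ) (n : ℤ) : scalarUnitary B t ^ n = scalarUnitary B (t * n) := by
  have h := map_zpow (MonoidHom.mk' (fun s : Multiplicative ℝ => scalarUnitary B s.toAdd)
    fun s t => scalarUnitary_add s.toAdd t.toAdd) (Multiplicative.ofAdd t) n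
  rw [← ofAdd_zsmul] at h
  rw [mul_comm, ← zsmul_eq_mul]
  exact h.symm

/-- The Weyl monomial `V^n U^m`. -/
def weyl (U V : unitary B) (k : ℤ × ℤ) : B := ((V ^ k.2 * U ^ k.1 : unitary B) : B)

variable {β : ℝ} {U V : unitary B}

lemma zpow_mul_zpow_unitary (hUV : (U * V : B) = e β • (V * U : B)) (m n : ℤ) :
    ((U ^ m * V ^ n : unitary B) : B) = e (β * (m * n)) • weyl U V (m, n) := by
  have h : U * V = scalarUnitary B β * (V * U) := Subtype.ext (by
    rw [coe_scalarUnitary_mul]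
    exact hUV)
  rw [zpow_mul_zpow_of_mul_eq (commute_scalarUnitary β U) (commute_scalarUnitary β V) h,
    scalarUnitary_zpow, coe_scalarUnitary_mul, weyl]
  push_cast
  rfl

lemma weyl_zero (U V : unitary B) : weyl U V 0 = 1 := by simp [weyl]

lemma weyl_mul (hUV : (U * V : B) = e β • (V * U : B)) (k l : ℤ × ℤ) :
    weyl U V k * weyl U V l = e (β * (k.1 * l.2)) • weyl U V (k + l) := by
  have h := zpow_mul_zpow_unitary hUV k.1 l.2
  calc weyl U V k * weyl U V l
      = ((V ^ k.2 : unitary B) : B) * ((U ^ k.1 * V ^ l.2 : unitary B) : B) *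
          ((U ^ l.1 : unitary B) : B) := by
        simp only [weyl, Submonoid.coe_mul, mul_assoc]
    _ = e (β * (k.1 * l.2)) • (((V ^ k.2 : unitary B) : B) * ((V ^ l.2 * U ^ k.1 : unitary B) : B) *
          ((U ^ l.1 : unitary B) : B)) := by
        rw [h, mul_smul_comm, smul_mul_assoc, weyl]
    _ = _ := by
        congr 1
        simp only [weyl, Prod.fst_add, Prod.snd_add, zpow_add, Submonoid.coe_mul, mul_assoc]

lemma star_weyl (hUV : (U * V : B) = e β • (V * U : B)) (k : ℤ × ℤ) :
    star (weyl U V k) = e (β * (k.1 * k.2)) • weyl U V (-k) := by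
  have h1 : weyl U V k * (e (β * (k.1 * k.2)) • weyl U V (-k)) = 1 := by
    rw [mul_smul_comm, weyl_mul hUV, smul_smul, ← e_add, add_neg_cancel, weyl_zero]
    simp [e_zero]
  have h2 : star (weyl U V k) * weyl U V k = 1 :=
    Unitary.coe_star_mul_self (V ^ k.2 * U ^ k.1)
  calc star (weyl U V k) = star (weyl U V k) * (weyl U V k * _) := by rw [h1, mul_one]
    _ = _ := by rw [← mul_assoc, h2, one_mul]

lemma norm_weyl_le (U V : unitary B) (k : ℤ × ℤ) : ‖weyl U V k‖ ≤ 1 := by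
  rcases subsingleton_or_nontrivial B with _ | _
  · rw [Subsingleton.elim (weyl U V k) 0, norm_zero]
    exact zero_le_one
  · exact (CStarRing.norm_coe_unitary _).le

/-! ### The projection -/

lemma summable_norm_projCoeff_smul_weyl (hβ : 0 < β) (h : β ≤ 0.948) (U V : unitary B) :
    Summable fun k => ‖projCoeff β k • weyl U V k‖ := by
  refine (summable_norm_projCoeff hβ h).of_nonneg_of_le (fun _ => norm_nonneg _) fun k => ?_
  rw [norm_smul]
  exact mul_le_of_le_one_right (norm_nonneg _) (norm_weyl_le U V k)

/-- The projection `∑ α ⟨a⁻¹ f, π_w f⟩ V^n U^m`, `w = (m √β, n √β)`. -/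
def proj (β : ℝ) (U V : unitary B) : B := ∑' k, projCoeff β k • weyl U V k

lemma hasSum_proj (hβ : 0 < β) (h : β ≤ 0.948) (U V : unitary B) :
    HasSum (fun k => projCoeff β k • weyl U V k) (proj β U V) :=
  (summable_norm_projCoeff_smul_weyl hβ h U V).of_norm.hasSum

lemma isSelfAdjoint_proj (hβ : 0 < β) (h : β ≤ 0.948) (hUV : (U * V : B) = e β • (V * U : B)) :
    IsSelfAdjoint (proj β U V) := by
  refine HasSum.isSelfAdjoint (hasSum_proj hβ h U V) (Equiv.neg _) fun k => ?_
  have h1 := conj_projCoeff_neg hβ h (-k)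
  rw [neg_neg] at h1
  rw [star_smul, star_weyl hUV, smul_smul, Equiv.neg_apply, ← h1, ← starRingEnd_apply]
  simp

lemma isIdempotentElem_proj (hβ : 0 < β) (h : β ≤ 0.948)
    (hUV : (U * V : B) = e β • (V * U : B)) : IsIdempotentElem (proj β U V) := by
  have h1 := hasSum_proj hβ h U V
  have hn := summable_norm_projCoeff_smul_weyl hβ h U V
  have h2 := h1.mul_of_summable_norm h1 hn hn
  -- The change of indices `(l, k) ↦ (k, l - k)` groups the product by total degree `l`, exhibiting
  -- the twisted convolution.
  let E : (ℤ × ℤ) × (ℤ × ℤ) ≃ (ℤ × ℤ) × (ℤ × ℤ) :=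
    { toFun := fun q => (q.2, q.1 - q.2)
      invFun := fun q => (q.1 + q.2, q.1)
      left_inv := fun q => by simp
      right_inv := fun q => by simp }
  have h3 := E.hasSum_iff.2 h2
  refine (h3.prod_fiberwise fun l => ?_).unique h1
  have h4 := (hasSum_projCoeff_conv hβ h l).smul_const (weyl U V l)
  refine (congrArg (fun f => HasSum f _) (funext fun k => ?_)).mp h4
  change _ = projCoeff β k • weyl U V k * projCoeff β (l - k) • weyl U V (l - k)
  rw [smul_mul_smul_comm, weyl_mul hUV, add_sub_cancel, smul_smul]

lemma isStarProjection_proj (hβ : 0 < β) (h : β ≤ 0.948)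
    (hUV : (U * V : B) = e β • (V * U : B)) : IsStarProjection (proj β U V) :=
  ⟨isIdempotentElem_proj hβ h hUV, isSelfAdjoint_proj hβ h hUV⟩

lemma map_proj_eq_self (hβ : 0 < β) (h : β ≤ 0.948) (T : B →L[ℂ] B) (i : ℤ × ℤ ≃ ℤ × ℤ)
    (hT : ∀ k, projCoeff β k • T (weyl U V k) = projCoeff β (i k) • weyl U V (i k)) :
    T (proj β U V) = proj β U V := by
  have h1 := hasSum_proj hβ h U V
  have h2 := T.hasSum h1
  simp only [map_smul, hT] at h2
  exact h2.unique (i.hasSum_iff.2 h1)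

lemma map_proj_eq_of_trace (hβ : 0 < β) (h : β ≤ 0.948) (T : B →L[ℂ] ℂ)
    (hT : ∀ k, T (weyl U V k) = if k = 0 then 1 else 0) : T (proj β U V) = β := by
  have h2 := T.hasSum (hasSum_proj hβ h U V)
  simp only [map_smul, hT, smul_eq_mul] at h2
  rw [← projCoeff_zero hβ h]
  refine h2.unique ?_
  have h3 := hasSum_ite_eq (0 : ℤ × ℤ) (projCoeff β 0)
  refine (congrArg (fun f => HasSum f _) (funext fun k => ?_)).mp h3
  by_cases hk : k = 0
  · simp [hk]
  · simp [hk]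

end Weyl

/-! ### Trace and rotation on Weyl monomials of the rotation algebra -/

/-- The automorphism `σ` as a continuous linear map. -/
def σL (α : ℝ) : A α →L[ℂ] A α := ⟨(σ α : A α →ₗ[ℂ] A α), (StarAlgEquiv.isometry (σ α)).continuous⟩

/-- Exchanging the generators replaces `α` by `-α`, that is by `1 - α` modulo `ℤ`. -/
lemma v_mul_u {α : ℝ} : (v α * u α : A α) = e (1 - α) • (u α * v α : A α) := by
  rw [u_mul_v, smul_smul, ← e_add, sub_add_cancel, show (1 : ℝ) = ((1 : ℤ) : ℝ) by simp, e_int,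
    one_smul]

lemma τ_weyl (α : ℝ) (k : ℤ × ℤ) : τ α (weyl (u α) (v α) k) = if k = 0 then 1 else 0 := by
  have h1 := zpow_mul_zpow_unitary (u_mul_v α) k.1 k.2
  have h2 := τ_monomial α k.1 k.2
  rw [h1, map_smul, smul_eq_mul] at h2
  by_cases hk : k = 0
  · subst hk
    simpa only [Prod.fst_zero, Prod.snd_zero, Int.cast_zero, mul_zero, e_zero, one_mul, and_self,
      if_true, Prod.mk_zero_zero] using h2
  · rw [if_neg fun h => hk (Prod.ext h.1 h.2)] at h2
    rw [if_neg hk]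
    exact (mul_eq_zero.1 h2).resolve_left (e_ne_zero _)

lemma τ_weyl_swap (α : ℝ) (k : ℤ × ℤ) : τ α (weyl (v α) (u α) k) = if k = 0 then 1 else 0 := by
  rw [weyl, τ_monomial]
  simp [Prod.ext_iff, and_comm]

lemma σ_weyl (α : ℝ) (U V U' V' : unitary (A α)) (hU : σ α U = U') (hV : σ α V = V')
    (k : ℤ × ℤ) : σ α (weyl U V k) = weyl U' V' k := by
  let φ : A α →⋆* A α :=
    { toFun := σ α
      map_one' := map_one (σ α)
      map_mul' := map_mul (σ α)
      map_star' := map_star (σ α) }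
  have hU' : Unitary.map φ U = U' := Subtype.ext hU
  have hV' : Unitary.map φ V = V' := Subtype.ext hV
  change ((Unitary.map φ (V ^ k.2 * U ^ k.1) : unitary (A α)) : A α) = _
  rw [map_mul, map_zpow, map_zpow, hU', hV', weyl]

lemma σ_weyl_u_v (α : ℝ) (k : ℤ × ℤ) :
    σ α (weyl (u α) (v α) k) = e (-(α * (k.1 * k.2))) • weyl (u α) (v α) (turn k) := by
  have h := zpow_mul_zpow_unitary (u_mul_v α) (-k.2) k.1
  rw [σ_weyl α _ _ _ _ (σ_u α) (σ_v α), weyl, inv_zpow', h, turn]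
  congr 2
  push_cast
  ring

lemma σ_weyl_v_u (α : ℝ) (k : ℤ × ℤ) : σ α (weyl (v α) (u α) k) =
    e (-((1 - α) * (k.1 * k.2))) • weyl (v α) (u α) (turnEquiv k) := by
  have h := zpow_mul_zpow_unitary (v_mul_u (α := α)) k.2 (-k.1)
  rw [σ_weyl α _ _ _ _ (σ_v α) (σ_u α), weyl, inv_zpow', h]
  congr 2
  push_cast
  ring

lemma σ_proj_u_v {α : ℝ} (h0 : 0 < α) (h : α ≤ 0.948) :
    σ α (proj α (u α) (v α)) = proj α (u α) (v α) := by
  refine map_proj_eq_self h0 h (σL α) turnEquiv.symm fun k => ?_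
  change projCoeff α k • σ α (weyl (u α) (v α) k) =
    projCoeff α (turn k) • weyl (u α) (v α) (turn k)
  rw [σ_weyl_u_v, smul_smul, projCoeff_turn h0 h k, mul_right_comm, ← e_add, add_neg_cancel,
    e_zero, one_mul]

/-- With the generators exchanged, `σ` turns the index the other way, so `projCoeff_turn` is applied
at `turnEquiv k`, whose turn is `k`. -/
lemma σ_proj_v_u {α : ℝ} (h0 : 0 < 1 - α) (h : 1 - α ≤ 0.948) :
    σ α (proj (1 - α) (v α) (u α)) = proj (1 - α) (v α) (u α) := by
  refine map_proj_eq_self h0 h (σL α) turnEquiv fun k => ?_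
  change projCoeff (1 - α) k • σ α (weyl (v α) (u α) k) = _
  have h1 : turn (turnEquiv k) = k := by simp [turn, turnEquiv]
  have h2 : (((turnEquiv k).1 : ℤ) * (turnEquiv k).2 : ℝ) = -(k.1 * k.2) := by
    simp [turnEquiv, mul_comm]
  rw [σ_weyl_v_u, smul_smul, projCoeff_turn h0 h (turnEquiv k), h1, h2, mul_neg, mul_comm]

end Rotation

end

/-! ### The theorem: the Gaussian projection, or the complement of one -/

theorem corollary1p5 (α : ℝ) (h0 : 0 < α) (h1 : α < 1) :
    ∃ p : Rotation.A α, IsStarProjection p ∧ Rotation.τ α p = α ∧ Rotation.σ α p = p ∧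
      (α ≤ 0.948 →
        Summable (fun k : ℤ × ℤ =>
          Rotation.innerDperp Rotation.gauss Rotation.gauss (Rotation.ptDperp α k) •
            star (Rotation.shift (Rotation.ptDperp α k))) ∧
        0 ≤ Rotation.opA α ∧ IsUnit (Rotation.opA α) ∧
        Rotation.IsInnerD α (Rotation.gaussTight α) p) := by
  by_cases h : α ≤ 0.948
  · refine ⟨Rotation.proj α (Rotation.u α) (Rotation.v α),
      Rotation.isStarProjection_proj h0 h (Rotation.u_mul_v α),
      Rotation.map_proj_eq_of_trace h0 h _ (Rotation.τ_weyl α), Rotation.σ_proj_u_v h0 h,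
      fun _ => ⟨Rotation.summable_opA h0, Rotation.opA_nonneg h0 h, Rotation.isUnit_opA h0 h, ?_⟩⟩
    have h2 := Rotation.hasSum_proj h0 h (Rotation.u α) (Rotation.v α)
    simp only [← Rotation.innerD_gaussTight h0 h] at h2
    exact h2
  · have h0' : 0 < 1 - α := sub_pos.2 h1
    -- Here `1 - α < 0.052`, so the construction applies to `(v, u)` and gives trace `1 - α`; its
    -- complement is the required projection.
    have h' : 1 - α ≤ 0.948 := by norm_num at h ⊢; linarith
    have h2 := Rotation.map_proj_eq_of_trace h0' h' _ (Rotation.τ_weyl_swap α)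
    have h3 : Rotation.τ α 1 = 1 := by
      have := Rotation.τ_monomial α 0 0
      simpa using this
    refine ⟨1 - Rotation.proj (1 - α) (Rotation.v α) (Rotation.u α),
      (Rotation.isStarProjection_proj h0' h' Rotation.v_mul_u).one_sub, ?_, ?_,
      fun hc => absurd hc h⟩
    · rw [map_sub, h2, h3]
      push_cast
      ring
    · rw [map_sub, map_one, Rotation.σ_proj_v_u h0' h']
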